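/- **Conventions.** A unital Banach ring is a (not necessarily commutative) ring $R$ with identity, complete for a norm $\|\cdot\|$ on its additive group with $\|xy\|\le\|x\|\|y\|$ and $\|1\|=1$. A complete valuation field is a field that is complete for a (possibly trivial) real absolute value $|\cdot|$ satisfying the triangle inequality; it is non-Archimedean if $|x+y|\le\max\{|x|,|y|\}$, and minimal if it contains no complete valuation subfield other than itself. Fix an infinite cardinal $\alpha$ and let $\mathcal K$ be the collection of complete valuation fields of cardinality at most $2^\alpha$; let $\mathcal K^{\mathrm{um}}$ be the non-Archimedean ones among them, and $\mathcal K^{\mathrm{um},\min}$ the minimal non-Archimedean ones. An additive map $\psi$ is contractive if $\|\psi(x)\|\le\|x\|$ for all $x$. For a unital Banach ring $R$ and $K\in\mathcal K$, let $R\hat\otimes_{\mathbb Z}K$ and $R\hat\otimes^{\mathrm{um}}_{\mathbb Z}K$ be the rings obtained from $R\otimes_{\mathbb Z}K$ by dividing out the kernel of, and completing for, respectively, the seminorms $$\|z\|_\wedge=\inf\sum_{k=1}^n\|a_k\||b_k|,\qquad \|z\|^{\mathrm{um}}_\wedge=\inf\max_{1\le k\le n}\|a_k\||b_k|,$$ the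 infima being over all representations $z=\sum_{k=1}^n a_k\otimes b_k$ with $a_k\in R$, $b_k\in K$. Let $\mathbb A^1_{\mathbb Z_1}$ be the set of non-zero multiplicative seminorms on $\mathbb Z[\mathbf t]$, with the topology of pointwise convergence. For $K_1,K_2\in\mathcal K$ and $s_i\in K_i$, write $(K_1,s_1)\sim(K_2,s_2)$ if there are $K\in\mathcal K$, $s\in K$ and contractive unital ring homomorphisms $\varphi_i:K\to K_i$ with $\varphi_i(s)=s_i$ ($i=1,2$). The class $(K,s)_\sim$ is identified with the seminorm $\mathbf p\mapsto|\mathbf p(s)|_K$ in $\mathbb A^1_{\mathbb Z_1}$. For $a\in R$, let $\sigma^{\mathrm{Ber}}_R(a)\subseteq\mathbb A^1_{\mathbb Z_1}$ be the set of all classes $(K,s)_\sim$ with $K\in\mathcal K$, $s\in K$, such that $R\hat\otimes_{\mathbb Z}K\ne(0)$ and $1\otimes s-a\otimes1$ is not invertible in $R\hat\otimes_{\mathbb Z}K$. Define $\sigma^{\mathrm{um}}_R(a)$ in the same way with $\hat\otimes^{\mathrm{um}}_{\mathbb Z}$ in place of $\hat\otimes_{\mathbb Z}$. **Theorem.** Let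 $R$ be a unital Banach ring and $a\in R$. (a) $\sigma^{\mathrm{um}}_R(a)$ and $\sigma^{\mathrm{Ber}}_R(a)$ are (possibly empty) compact subsets of $\mathbb A^1_{\mathbb Z_1}$. (b) The following are equivalent: (i) $\sigma^{\mathrm{um}}_R(a)\neq\emptyset$; (ii) there exists $K\in\mathcal K^{\mathrm{um},\min}$ with $R\hat\otimes^{\mathrm{um}}_{\mathbb Z}K\ne(0)$; (iii) there is a non-zero contractive additive map from $R$ to some $L\in\mathcal K^{\mathrm{um}}$. (c) If there is a non-zero contractive additive map from $R$ to some $L\in\mathcal K$, then $\sigma^{\mathrm{Ber}}_R(a)\ne\emptyset$. -/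

import Mathlib

open scoped TensorProduct Polynomial

universe u v

namespace BanachRing

/-! ### Projective tensor products over `ℤ` -/

section Tensor

variable (R : Type u) (S : Type v) [NormedRing R] [NormedRing S]

/-- The values `∑ ‖a k‖ ‖b k‖` over all representations `z = ∑ a k ⊗ b k` as a finite sum. -/
def projCosts (z : R ⊗[ℤ] S) : Set ℝ :=
  {c | ∃ (n : ℕ) (a : Fin n → R) (b : Fin n → S),
    z = ∑ k, a k ⊗ₜ[ℤ] b k ∧ c = ∑ k, ‖a k‖ * ‖b k‖}

/-- The values `max ‖a k‖ ‖b k‖` over all representations `z = ∑ a k ⊗ b k` as a finite sum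
(the maximum over the empty family, which represents `0 = 0 ⊗ 0`, is `0`). -/
def umCosts (z : R ⊗[ℤ] S) : Set ℝ :=
  {c | ∃ (n : ℕ) (a : Fin n → R) (b : Fin n → S),
    z = ∑ k, a k ⊗ₜ[ℤ] b k ∧ c = ⨆ k, ‖a k‖ * ‖b k‖}

variable {R S}

lemma exists_rep (z : R ⊗[ℤ] S) :
    ∃ (n : ℕ) (a : Fin n → R) (b : Fin n → S), z = ∑ k, a k ⊗ₜ[ℤ] b k := by
  induction z using TensorProduct.induction_on with
  | zero => exact ⟨0, Fin.elim0, Fin.elim0, by simp⟩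
  | tmul x y => exact ⟨1, fun _ => x, fun _ => y, by simp⟩
  | add x y hx hy =>
    obtain ⟨n, a, b, rfl⟩ := hx
    obtain ⟨m, c, d, rfl⟩ := hy
    exact ⟨n + m, Fin.append a c, Fin.append b d, by simp [Fin.sum_univ_add]⟩

lemma projCosts_nonneg {z : R ⊗[ℤ] S} {c : ℝ} (hc : c ∈ projCosts R S z) : 0 ≤ c := by
  obtain ⟨n, a, b, -, rfl⟩ := hc
  exact Finset.sum_nonneg fun k _ => by positivity

lemma umCosts_nonneg {z : R ⊗[ℤ] S} {c : ℝ} (hc : c ∈ umCosts R S z) : 0 ≤ c := by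
  obtain ⟨n, a, b, -, rfl⟩ := hc
  exact Real.iSup_nonneg fun k => by positivity

lemma projCosts_nonempty (z : R ⊗[ℤ] S) : (projCosts R S z).Nonempty := by
  obtain ⟨n, a, b, h⟩ := exists_rep z
  exact ⟨_, n, a, b, h, rfl⟩

lemma umCosts_nonempty (z : R ⊗[ℤ] S) : (umCosts R S z).Nonempty := by
  obtain ⟨n, a, b, h⟩ := exists_rep z
  exact ⟨_, n, a, b, h, rfl⟩

lemma sInf_projCosts_le {ι : Type*} [Fintype ι] (a : ι → R) (b : ι → S) :
    sInf (projCosts R S (∑ k, a k ⊗ₜ[ℤ] b k)) ≤ ∑ k, ‖a k‖ * ‖b k‖ := by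
  refine csInf_le ⟨0, fun c => projCosts_nonneg⟩ ?_
  let e := (Fintype.equivFin ι).symm
  exact ⟨Fintype.card ι, a ∘ e, b ∘ e, (e.sum_comp fun k => a k ⊗ₜ[ℤ] b k).symm,
    (e.sum_comp fun k => ‖a k‖ * ‖b k‖).symm⟩

lemma sInf_umCosts_le {ι : Type*} [Fintype ι] (a : ι → R) (b : ι → S) {c : ℝ} (hc : 0 ≤ c)
    (h : ∀ k, ‖a k‖ * ‖b k‖ ≤ c) :
    sInf (umCosts R S (∑ k, a k ⊗ₜ[ℤ] b k)) ≤ c := by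
  let e := (Fintype.equivFin ι).symm
  refine (csInf_le ⟨0, fun c => umCosts_nonneg⟩
    ⟨Fintype.card ι, a ∘ e, b ∘ e, (e.sum_comp fun k => a k ⊗ₜ[ℤ] b k).symm, rfl⟩).trans ?_
  exact Real.iSup_le (fun k => h (e k)) hc

lemma exists_of_sInf_projCosts_lt {z : R ⊗[ℤ] S} {c : ℝ} (h : sInf (projCosts R S z) < c) :
    ∃ (n : ℕ) (a : Fin n → R) (b : Fin n → S),
      z = ∑ k, a k ⊗ₜ[ℤ] b k ∧ ∑ k, ‖a k‖ * ‖b k‖ < c := by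
  obtain ⟨_, ⟨n, a, b, hz, rfl⟩, hc⟩ := exists_lt_of_csInf_lt (projCosts_nonempty z) h
  exact ⟨n, a, b, hz, hc⟩

lemma exists_of_sInf_umCosts_lt {z : R ⊗[ℤ] S} {c : ℝ} (h : sInf (umCosts R S z) < c) :
    0 < c ∧ ∃ (n : ℕ) (a : Fin n → R) (b : Fin n → S),
      z = ∑ k, a k ⊗ₜ[ℤ] b k ∧ ∀ k, ‖a k‖ * ‖b k‖ < c := by
  obtain ⟨_, hd, hc⟩ := exists_lt_of_csInf_lt (umCosts_nonempty z) h
  have h0 := umCosts_nonneg hd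
  obtain ⟨n, a, b, hz, rfl⟩ := hd
  exact ⟨h0.trans_lt hc, n, a, b, hz, fun k =>
    (le_ciSup (f := fun k => ‖a k‖ * ‖b k‖) (Set.finite_range _).bddAbove k).trans_lt hc⟩

variable (R S)

/-- The projective seminorm on `R ⊗ S`: the infimum of `∑ ‖a k‖ ‖b k‖` over all
representations. -/
noncomputable def projSeminorm : RingSeminorm (R ⊗[ℤ] S) where
  toFun z := sInf (projCosts R S z)
  map_zero' := by
    refine le_antisymm ?_ (Real.sInf_nonneg fun c => projCosts_nonneg)
    simpa using sInf_projCosts_le (R := R) (S := S) (Fin.elim0 : Fin 0 → R) Fin.elim0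
  add_le' x y := by
    refine le_of_forall_pos_le_add fun ε hε => ?_
    obtain ⟨n, a, b, hx, h1⟩ := exists_of_sInf_projCosts_lt
      (lt_add_of_pos_right (sInf (projCosts R S x)) (half_pos hε))
    obtain ⟨m, c, d, hy, h2⟩ := exists_of_sInf_projCosts_lt
      (lt_add_of_pos_right (sInf (projCosts R S y)) (half_pos hε))
    have := sInf_projCosts_le (Sum.elim a c) (Sum.elim b d)
    simp only [Fintype.sum_sum_type, Sum.elim_inl, Sum.elim_inr, ← hx, ← hy] at this
    linarith
  neg' x := by
    have key : projCosts R S (-x) = projCosts R S x := by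
      ext c
      constructor
      · rintro ⟨n, a, b, hx, hc⟩
        exact ⟨n, fun k => -a k, b, by simp [TensorProduct.neg_tmul, ← hx], by simpa using hc⟩
      · rintro ⟨n, a, b, hx, hc⟩
        exact ⟨n, fun k => -a k, b, by simp [TensorProduct.neg_tmul, ← hx], by simpa using hc⟩
    rw [key]
  mul_le' x y := by
    refine le_mul_of_forall_lt₀ fun p hp q hq => ?_
    obtain ⟨n, a, b, hx, h1⟩ := exists_of_sInf_projCosts_lt hp
    obtain ⟨m, c, d, hy, h2⟩ := exists_of_sInf_projCosts_lt hq
    have := sInf_projCosts_le (fun k : Fin n × Fin m => a k.1 * c k.2)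
      (fun k : Fin n × Fin m => b k.1 * d k.2)
    have hxy : x * y = ∑ k : Fin n × Fin m, (a k.1 * c k.2) ⊗ₜ[ℤ] (b k.1 * d k.2) := by
      rw [hx, hy, Finset.sum_mul_sum, Fintype.sum_prod_type]
      simp
    rw [← hxy] at this
    have h0 : (0 : ℝ) ≤ ∑ k, ‖a k‖ * ‖b k‖ := Finset.sum_nonneg fun k _ => by positivity
    have h0' : (0 : ℝ) ≤ ∑ k, ‖c k‖ * ‖d k‖ := Finset.sum_nonneg fun k _ => by positivity
    calc _ ≤ _ := this
      _ ≤ ∑ k : Fin n × Fin m, (‖a k.1‖ * ‖b k.1‖) * (‖c k.2‖ * ‖d k.2‖) := by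
        refine Finset.sum_le_sum fun k _ => ?_
        rw [mul_mul_mul_comm]
        gcongr <;> exact norm_mul_le _ _
      _ = (∑ k, ‖a k‖ * ‖b k‖) * ∑ k, ‖c k‖ * ‖d k‖ := by
        rw [Finset.sum_mul_sum, Fintype.sum_prod_type]
      _ ≤ p * q := mul_le_mul h1.le h2.le h0' (h0.trans h1.le)

/-- The ultrametric projective seminorm on `R ⊗ S`: the infimum of `max ‖a k‖ ‖b k‖` over all
representations. -/
noncomputable def umSeminorm : RingSeminorm (R ⊗[ℤ] S) where
  toFun z := sInf (umCosts R S z)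
  map_zero' := by
    refine le_antisymm ?_ (Real.sInf_nonneg fun c => umCosts_nonneg)
    simpa using sInf_umCosts_le (R := R) (S := S) (Fin.elim0 : Fin 0 → R) Fin.elim0 le_rfl
      (fun k => k.elim0)
  add_le' x y := by
    refine le_of_forall_pos_le_add fun ε hε => ?_
    obtain ⟨hp, n, a, b, hx, h1⟩ := exists_of_sInf_umCosts_lt
      (lt_add_of_pos_right (sInf (umCosts R S x)) (half_pos hε))
    obtain ⟨hq, m, c, d, hy, h2⟩ := exists_of_sInf_umCosts_lt
      (lt_add_of_pos_right (sInf (umCosts R S y)) (half_pos hε))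
    have := sInf_umCosts_le (Sum.elim a c) (Sum.elim b d) (add_pos hp hq).le (by
      rintro (k | k)
      · simpa using (h1 k).le.trans (by linarith)
      · simpa using (h2 k).le.trans (by linarith))
    simp only [Fintype.sum_sum_type, Sum.elim_inl, Sum.elim_inr, ← hx, ← hy] at this
    linarith
  neg' x := by
    have key : umCosts R S (-x) = umCosts R S x := by
      ext c
      constructor
      · rintro ⟨n, a, b, hx, hc⟩
        exact ⟨n, fun k => -a k, b, by simp [TensorProduct.neg_tmul, ← hx], by simpa using hc⟩
      · rintro ⟨n, a, b, hx, hc⟩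
        exact ⟨n, fun k => -a k, b, by simp [TensorProduct.neg_tmul, ← hx], by simpa using hc⟩
    rw [key]
  mul_le' x y := by
    refine le_mul_of_forall_lt₀ fun p hp q hq => ?_
    obtain ⟨hp0, n, a, b, hx, h1⟩ := exists_of_sInf_umCosts_lt hp
    obtain ⟨hq0, m, c, d, hy, h2⟩ := exists_of_sInf_umCosts_lt hq
    have hxy : x * y = ∑ k : Fin n × Fin m, (a k.1 * c k.2) ⊗ₜ[ℤ] (b k.1 * d k.2) := by
      rw [hx, hy, Finset.sum_mul_sum, Fintype.sum_prod_type]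
      simp
    rw [hxy]
    refine sInf_umCosts_le _ _ (mul_pos hp0 hq0).le fun k => ?_
    calc ‖a k.1 * c k.2‖ * ‖b k.1 * d k.2‖
        ≤ (‖a k.1‖ * ‖c k.2‖) * (‖b k.1‖ * ‖d k.2‖) := by
          gcongr <;> exact norm_mul_le _ _
      _ = (‖a k.1‖ * ‖b k.1‖) * (‖c k.2‖ * ‖d k.2‖) := mul_mul_mul_comm _ _ _ _
      _ ≤ p * q := mul_le_mul (h1 _).le (h2 _).le (by positivity) hp0.le

/-- The ring `R ⊗ S` over `ℤ`, regarded with the projective seminorm. -/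
def ProjTensor : Type (max u v) := R ⊗[ℤ] S

noncomputable instance : SeminormedRing (ProjTensor R S) :=
  RingSeminorm.toSeminormedRing (R := R ⊗[ℤ] S) (projSeminorm R S)

/-- The ring `R ⊗ S` over `ℤ`, regarded with the ultrametric projective seminorm. -/
def UmTensor : Type (max u v) := R ⊗[ℤ] S

noncomputable instance : SeminormedRing (UmTensor R S) :=
  RingSeminorm.toSeminormedRing (R := R ⊗[ℤ] S) (umSeminorm R S)

/-- The projective Banach ring tensor product: the Hausdorff completion of `R ⊗ S`, i.e. the
completion of the quotient of `R ⊗ S` by the kernel of the projective seminorm. -/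
abbrev BanachTensor : Type (max u v) := UniformSpace.Completion (ProjTensor R S)

/-- The ultrametric projective Banach ring tensor product. -/
abbrev UmBanachTensor : Type (max u v) := UniformSpace.Completion (UmTensor R S)

variable {R S}

/-- The element `1 ⊗ s - a ⊗ 1` of the projective Banach ring tensor product. -/
noncomputable def shift (a : R) (s : S) : BanachTensor R S :=
  ((show ProjTensor R S from ((1 : R) ⊗ₜ[ℤ] s - a ⊗ₜ[ℤ] (1 : S))) : BanachTensor R S)

/-- The element `1 ⊗ s - a ⊗ 1` of the ultrametric projective Banach ring tensor product. -/
noncomputable def umShift (a : R) (s : S) : UmBanachTensor R S :=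
  ((show UmTensor R S from ((1 : R) ⊗ₜ[ℤ] s - a ⊗ₜ[ℤ] (1 : S))) : UmBanachTensor R S)

end Tensor

/-! ### Complete valuation fields and the universal space of scalars -/

/-- A complete valuation field (a field complete for a real absolute value, which may be trivial)
of cardinality at most `2 ^ α`. -/
structure ValField (α : Cardinal.{v}) where
  carrier : Type v
  [normedField : NormedField carrier]
  [complete : CompleteSpace carrier]
  card_le : Cardinal.mk carrier ≤ 2 ^ α

attribute [instance] ValField.normedField ValField.complete

instance (α : Cardinal.{v}) : CoeSort (ValField α) (Type v) := ⟨ValField.carrier⟩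

/-- `K` is non-Archimedean. -/
def ValField.IsUm {α : Cardinal.{v}} (K : ValField α) : Prop := IsUltrametricDist K

/-- `K` is minimal: it is its only complete valuation subfield. -/
def ValField.IsMinimal {α : Cardinal.{v}} (K : ValField α) : Prop :=
  ∀ F : Subfield K, IsComplete (F : Set K) → F = ⊤

/-- The relation `(K₁, s₁) ∼ (K₂, s₂)` between elements of complete valuation fields: there are
a complete valuation field `K`, an element `s` of it, and contractive unital ring homomorphisms
`K → K₁` and `K → K₂` that send `s` to `s₁` and `s₂`. -/
def ScalarRel (α : Cardinal.{v}) (x y : Σ K : ValField α, K) : Prop :=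
  ∃ (K : ValField α) (s : K) (f : K →+* x.1) (g : K →+* y.1),
    (∀ t, ‖f t‖ ≤ ‖t‖) ∧ (∀ t, ‖g t‖ ≤ ‖t‖) ∧ f s = x.2 ∧ g s = y.2

/-- The universal space of scalars: the equivalence classes of elements of complete valuation
fields. -/
def Scalars (α : Cardinal.{v}) : Type (v + 1) := Quot (ScalarRel α)

/-- The class `(K, s)_∼`. -/
def scalarClass {α : Cardinal.{v}} (K : ValField α) (s : K) : Scalars α :=
  Quot.mk _ ⟨K, s⟩

/-- The affine analytic line over `ℤ` with the Euclidean norm: all non-zero multiplicative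
seminorms on `ℤ[t]`. -/
def AffineLine : Type := MulRingSeminorm ℤ[X]

/-- The topology of pointwise convergence on `ℤ[t]`. -/
noncomputable instance : TopologicalSpace AffineLine :=
  TopologicalSpace.induced (fun (l : MulRingSeminorm ℤ[X]) (p : ℤ[X]) => l p) inferInstance

/-- The multiplicative seminorm `p ↦ ‖p(s)‖` on `ℤ[t]`. -/
noncomputable def evalSeminorm {K : Type v} [NormedField K] (s : K) : AffineLine :=
  show MulRingSeminorm ℤ[X] from
  { toFun := fun p => ‖Polynomial.aeval s p‖
    map_zero' := by simp
    add_le' := fun p q => by simpa using norm_add_le _ _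
    neg' := fun p => by simp
    map_one' := by simp
    map_mul' := fun p q => by simp }

lemma norm_eq_of_contractive {K L : Type v} [NormedField K] [NormedField L] (f : K →+* L)
    (hf : ∀ t, ‖f t‖ ≤ ‖t‖) (t : K) : ‖f t‖ = ‖t‖ := by
  rcases eq_or_ne t 0 with rfl | ht
  · simp
  · refine le_antisymm (hf t) ?_
    have h := hf t⁻¹
    rw [map_inv₀, norm_inv, norm_inv] at h
    exact (inv_le_inv₀ (norm_pos_iff.2 ((map_ne_zero f).2 ht)) (norm_pos_iff.2 ht)).1 h

lemma evalSeminorm_eq {K L : Type v} [NormedField K] [NormedField L] (f : K →+* L)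
    (hf : ∀ t, ‖f t‖ ≤ ‖t‖) (s : K) : evalSeminorm (f s) = evalSeminorm s := by
  refine DFunLike.ext (F := MulRingSeminorm ℤ[X]) _ _ fun p => ?_
  change ‖Polynomial.aeval (f s) p‖ = ‖Polynomial.aeval s p‖
  rw [← norm_eq_of_contractive f hf]
  congr 1
  simp only [Polynomial.aeval_def, Polynomial.hom_eval₂]
  congr 1
  exact Subsingleton.elim _ _

/-- The identification of the universal space of scalars with the affine analytic line, which
sends the class of `(K, s)` to the seminorm `p ↦ ‖p(s)‖`. -/
noncomputable def toAffineLine {α : Cardinal.{v}} : Scalars α → AffineLine :=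
  Quot.lift (fun x => evalSeminorm x.2) (by
    rintro x y ⟨K, s, f, g, hf, hg, hx, hy⟩
    rw [← hx, ← hy]
    exact (evalSeminorm_eq f hf s).trans (evalSeminorm_eq g hg s).symm)

/-! ### Spectra -/

section Spectra

variable {R : Type u} [NormedRing R]

/-- The Berkovich spectrum of `a`, as a set of classes of scalars. -/
def berScalars (α : Cardinal.{v}) (a : R) : Set (Scalars α) :=
  {x | ∃ (K : ValField α) (s : K), scalarClass K s = x ∧
    Nontrivial (BanachTensor R K) ∧ ¬ IsUnit (shift a s)}

/-- The ultrametric Berkovich spectrum of `a`, as a set of classes of scalars. -/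
def umScalars (α : Cardinal.{v}) (a : R) : Set (Scalars α) :=
  {x | ∃ (K : ValField α) (s : K), scalarClass K s = x ∧
    Nontrivial (UmBanachTensor R K) ∧ ¬ IsUnit (umShift a s)}

/-- The Berkovich spectrum of `a`, as a subset of the affine analytic line. -/
def berSpectrum (α : Cardinal.{v}) (a : R) : Set AffineLine :=
  toAffineLine '' berScalars α a

/-- The ultrametric Berkovich spectrum of `a`, as a subset of the affine analytic line. -/
def umSpectrum (α : Cardinal.{v}) (a : R) : Set AffineLine :=
  toAffineLine '' umScalars α a

end Spectra

end BanachRing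

open BanachRing

-- Both spectra are described without fields. A point of the spectrum, given by `s` in `K`, pulls
-- the norm of the completed tensor product back along `X ↦ 1 ⊗ s` to a seminorm on `R[X]` that is
-- contractive on `R`, multiplicative along `ℤ[X]`, and for which `X - a` stays non-invertible even
-- after division by integer polynomials (`IsSpectral`). Conversely, localizing such a seminorm at
-- the integer polynomials where it does not vanish and completing gives a Banach ring in which the
-- closure of the fractions is a complete valuation field, hence a point
-- (`IsSpectral.exists_scalar`). So the spectrum is the image of the set of spectral seminorms
-- (`berSpectrum_eq_range`, `umSpectrum_eq_range`). The defining conditions are closed, and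
-- non-invertibility forces `N X ≤ ‖a‖`, so Tychonoff's theorem gives compactness. An operation
-- `op`, either `+` or `max`, treats the two tensor products together.
--
-- Spectral seminorms are found by Zorn's lemma, as minimal seminorms for which `u = X - a` is not
-- invertible (`exists_minimal_seminorm`). For a central `f` and `r > 0`, the parts `|f| ≤ r` and
-- `|f| ≥ r` carry smaller seminorms. A Cousin-type gluing (`inv_of_parts`) shows that `u` is
-- non-invertible on one of them, so by minimality that one equals `N`; letting `r` increase to `N
-- f` makes `N` multiplicative on central elements. Zorn's lemma starts from `R ⊗ ℤ[a]` with `X ↦ 1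
-- ⊗ a`: the additive map `r ⊗ s ↦ s r` kills the right ideal of `1 ⊗ a - a ⊗ 1`, so it is enough
-- that elements mapping to `1` have norm at least `1`. For sums this is `‖1‖ = 1`; for maxima it
-- follows from a non-zero contractive map to an ultrametric field.
--
-- For the remaining implications in (b), the closure of the prime field of `K` is minimal, minimal
-- fields are spherically complete, and Ingleton's extension theorem yields a contractive functional
-- on the tensor product that is `1` at `1`.

universe w

namespace BanachRing

section

open Filter Topology Polynomial
open scoped NNReal

/-! ### Aggregated costs and seminorms. -/

/-- A way `op` of aggregating costs: addition and the maximum are the two examples. -/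
structure IsAgg (op : ℝ≥0 → ℝ≥0 → ℝ≥0) : Prop where
  comm : ∀ x y, op x y = op y x
  assoc : ∀ x y z, op (op x y) z = op x (op y z)
  zero_right : ∀ x, op x 0 = x
  mul_left : ∀ c x y, c * op x y = op (c * x) (c * y)
  mono : ∀ {x x' y y'}, x ≤ x' → y ≤ y' → op x y ≤ op x' y'
  le_add : ∀ x y, op x y ≤ x + y
  continuous : Continuous fun p : ℝ≥0 × ℝ≥0 => op p.1 p.2

lemma isAgg_add : IsAgg (· + ·) where
  comm := add_comm
  assoc := add_assoc
  zero_right := add_zero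
  mul_left := mul_add
  mono := add_le_add
  le_add _ _ := le_rfl
  continuous := continuous_add

lemma isAgg_max : IsAgg max where
  comm := max_comm
  assoc := max_assoc
  zero_right _ := max_eq_left zero_le
  mul_left c x y := mul_max c x y
  mono := max_le_max
  le_add _ _ := max_le le_self_add le_add_self
  continuous := continuous_max

namespace IsAgg

variable {op : ℝ≥0 → ℝ≥0 → ℝ≥0} (hop : IsAgg op)
include hop

lemma mul_right (x y c : ℝ≥0) : op x y * c = op (x * c) (y * c) := by
  rw [mul_comm, hop.mul_left, mul_comm c, mul_comm c]

lemma le_left (x y : ℝ≥0) : x ≤ op x y := by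
  simpa [hop.zero_right] using hop.mono (le_refl x) (zero_le : 0 ≤ y)

lemma le_right (x y : ℝ≥0) : y ≤ op x y := hop.comm x y ▸ hop.le_left y x

/-- Infima of costs need not be attained; continuity of `op` passes from all slightly larger costs
to the infima. -/
lemma le_of_forall_lt {x y z : ℝ≥0} (h : ∀ x', x < x' → ∀ y', y < y' → z ≤ op x' y') :
    z ≤ op x y := by
  have hx : Tendsto (fun e : ℝ≥0 => op (x + e) (y + e)) (𝓝[>] 0) (𝓝 (op x y)) := by
    have : Continuous fun e : ℝ≥0 => op (x + e) (y + e) :=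
      hop.continuous.comp (by fun_prop : Continuous fun e : ℝ≥0 => (x + e, y + e))
    simpa using (this.tendsto 0).mono_left nhdsWithin_le_nhds
  refine ge_of_tendsto hx ?_
  filter_upwards [self_mem_nhdsWithin] with e he
  exact h _ (lt_add_of_pos_right _ he) _ (lt_add_of_pos_right _ he)

end IsAgg

variable {A : Type*} [Ring A]

/-- `N` is a submultiplicative seminorm on the ring `A` that is subadditive with respect
to `op`. -/
structure IsSN (op : ℝ≥0 → ℝ≥0 → ℝ≥0) (N : A → ℝ≥0) : Prop where
  zero : N 0 = 0
  one : N 1 ≤ 1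
  neg : ∀ x, N (-x) = N x
  add : ∀ x y, N (x + y) ≤ op (N x) (N y)
  mul : ∀ x y, N (x * y) ≤ N x * N y

lemma IsSN.pow {op : ℝ≥0 → ℝ≥0 → ℝ≥0} {N : A → ℝ≥0} (h : IsSN op N) (x : A) (n : ℕ) :
    N (x ^ n) ≤ N x ^ n := by
  induction n with
  | zero => simpa using h.one
  | succ n ih =>
    rw [pow_succ, pow_succ]
    exact (h.mul _ _).trans (by gcongr)

/-- `u` is invertible in the completion of `A` with respect to `N`. -/
def Inv (N : A → ℝ≥0) (u : A) : Prop := ∃ e, N (1 - u * e) < 1 ∧ N (1 - e * u) < 1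

/-! ### Polynomial representations in a central element. -/

/-- `Rep op N f r D b c` says that `b` is a sum of terms `x * f ^ i` with `i ≤ D` for which the
aggregate of the costs `N x * r ^ i` is at most `c`. -/
inductive Rep (op : ℝ≥0 → ℝ≥0 → ℝ≥0) (N : A → ℝ≥0) (f : A) (r : ℝ≥0) : ℕ → A → ℝ≥0 → Prop
  | zero (D : ℕ) (c : ℝ≥0) : Rep op N f r D 0 c
  | add {D : ℕ} {b : A} {c : ℝ≥0} (h : Rep op N f r D b c) (i : ℕ) (hi : i ≤ D) (x : A) (c' : ℝ≥0)
      (hc : op c (N x * r ^ i) ≤ c') : Rep op N f r D (b + x * f ^ i) c'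

namespace Rep

variable {op : ℝ≥0 → ℝ≥0 → ℝ≥0} {N : A → ℝ≥0} {f : A} {r : ℝ≥0}

lemma mono {D D' : ℕ} {b : A} {c c' : ℝ≥0} (h : Rep op N f r D b c) (hD : D ≤ D') (hc : c ≤ c') :
    Rep op N f r D' b c' := by
  induction h generalizing c' with
  | zero c => exact .zero _ _
  | @add b c h i hi x c'' hc' ih =>
    exact .add (ih le_rfl) i (hi.trans hD) x _ (hc'.trans hc)

variable (hop : IsAgg op)
include hop

lemma single (D i : ℕ) (hi : i ≤ D) (x : A) : Rep op N f r D (x * f ^ i) (N x * r ^ i) := by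
  simpa using Rep.add (Rep.zero (op := op) (N := N) (f := f) (r := r) D 0) i hi x _
    (by rw [hop.comm, hop.zero_right])

lemma const (x : A) : Rep op N f r 0 x (N x) := by
  simpa using single (N := N) (f := f) (r := r) hop 0 0 le_rfl x

lemma add' {D : ℕ} {b b' : A} {c c' : ℝ≥0} (h : Rep op N f r D b c) (h' : Rep op N f r D b' c') :
    Rep op N f r D (b + b') (op c c') := by
  induction h' with
  | zero c' => simpa using h.mono le_rfl (hop.le_left _ _)
  | @add b' c' h' i hi x c'' hc ih =>
    rw [← add_assoc]
    refine .add ih i hi x _ ?_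
    rw [hop.assoc]
    exact hop.mono le_rfl hc

lemma add_le {D : ℕ} {b b' : A} {c c' d : ℝ≥0} (h : Rep op N f r D b c)
    (h' : Rep op N f r D b' c') (hd : c + c' ≤ d) : Rep op N f r D (b + b') d :=
  (h.add' hop h').mono le_rfl ((hop.le_add _ _).trans hd)

variable (hN : IsSN op N) (hf : ∀ b, b * f = f * b)
include hN hf

lemma monomial_mul {D : ℕ} {b : A} {c : ℝ≥0} (h : Rep op N f r D b c) (i : ℕ) (x : A) :
    Rep op N f r (i + D) (x * f ^ i * b) (N x * r ^ i * c) := by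
  induction h with
  | zero c => simpa using Rep.zero _ _
  | @add b c h j hj y c' hc ih =>
    have e : x * f ^ i * (b + y * f ^ j) = x * f ^ i * b + x * y * f ^ (i + j) := by
      have : f ^ i * y = y * f ^ i := ((show Commute y f from hf y).pow_right i).eq.symm
      rw [mul_add, pow_add, mul_assoc x y, ← mul_assoc y, ← this]
      simp only [mul_assoc]
    rw [e]
    refine .add ih _ (by omega) _ _ ?_
    calc op (N x * r ^ i * c) (N (x * y) * r ^ (i + j))
        ≤ op (N x * r ^ i * c) (N x * r ^ i * (N y * r ^ j)) := by
          refine hop.mono le_rfl ?_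
          calc N (x * y) * r ^ (i + j) ≤ N x * N y * r ^ (i + j) := by gcongr; exact hN.mul _ _
            _ = _ := by ring
      _ = N x * r ^ i * op c (N y * r ^ j) := (hop.mul_left _ _ _).symm
      _ ≤ _ := by gcongr

lemma mul {D D' : ℕ} {b b' : A} {c c' : ℝ≥0} (h : Rep op N f r D b c)
    (h' : Rep op N f r D' b' c') : Rep op N f r (D + D') (b * b') (c * c') := by
  induction h with
  | zero c => simpa using Rep.zero _ _
  | @add b c h i hi x c'' hc ih =>
    rw [add_mul]
    refine ((ih.add' hop ((h'.monomial_mul hop hN hf i x).mono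
      (by omega : i + D' ≤ D + D') le_rfl)).mono le_rfl ?_)
    rw [← hop.mul_right]
    gcongr

lemma const_mul {D : ℕ} {b : A} {c : ℝ≥0} (h : Rep op N f r D b c) (x : A) :
    Rep op N f r D (x * b) (N x * c) := by
  simpa using (const hop x).mul hop hN hf h

lemma mul_const {D : ℕ} {b : A} {c : ℝ≥0} (h : Rep op N f r D b c) (x : A) :
    Rep op N f r D (b * x) (c * N x) := by
  simpa using h.mul hop hN hf (const hop x)

lemma neg {D : ℕ} {b : A} {c : ℝ≥0} (h : Rep op N f r D b c) : Rep op N f r D (-b) c := by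
  have := h.const_mul hop hN hf (-1)
  rw [neg_one_mul, hN.neg] at this
  exact this.mono le_rfl (mul_le_of_le_one_left zero_le hN.one)

omit hf in
lemma one : Rep op N f r 0 1 1 := (const hop 1).mono le_rfl hN.one

lemma pow_mul {D : ℕ} {b : A} {c : ℝ≥0} (h : Rep op N f r D b c) (i : ℕ) :
    Rep op N f r (i + D) (f ^ i * b) (r ^ i * c) := by
  have := h.monomial_mul hop hN hf i 1
  rw [one_mul] at this
  refine this.mono le_rfl ?_
  rw [mul_assoc]
  exact mul_le_of_le_one_left zero_le hN.one

lemma pow {D : ℕ} {b : A} {c : ℝ≥0} (h : Rep op N f r D b c) (n : ℕ) :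
    Rep op N f r (D * n) (b ^ n) (c ^ n) := by
  induction n with
  | zero => simpa using one hop hN
  | succ n ih =>
    rw [pow_succ, pow_succ]
    exact (ih.mul hop hN hf h).mono (by rw [mul_add, mul_one]) le_rfl

-- Terms of degree at most `M` form `b₁`; the others release a factor `f ^ M`. No cost is lost,
-- since `op` is associative and commutative.
omit hN in
lemma split {D : ℕ} {b : A} {c : ℝ≥0} (h : Rep op N f r D b c) (M : ℕ) :
    ∃ b₁ b₂ c₁ c₂, b = b₁ + f ^ M * b₂ ∧ Rep op N f r M b₁ c₁ ∧ Rep op N f r (D - M) b₂ c₂ ∧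
      op c₁ (r ^ M * c₂) ≤ c := by
  induction h with
  | zero c =>
    exact ⟨0, 0, 0, 0, by simp, .zero _ _, .zero _ _, by simp [hop.zero_right]⟩
  | @add b c h i hi x c' hc ih =>
    obtain ⟨b₁, b₂, c₁, c₂, rfl, h1, h2, h3⟩ := ih
    rcases le_total i M with hM | hM
    · refine ⟨b₁ + x * f ^ i, b₂, op c₁ (N x * r ^ i), c₂, by abel,
        .add h1 i hM x _ le_rfl, h2, ?_⟩
      rw [hop.assoc, hop.comm (N x * r ^ i), ← hop.assoc]
      exact (hop.mono h3 le_rfl).trans hc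
    · refine ⟨b₁, b₂ + x * f ^ (i - M), c₁, op c₂ (N x * r ^ (i - M)), ?_, h1,
        .add h2 _ (by omega) x _ le_rfl, ?_⟩
      · have : f ^ M * (x * f ^ (i - M)) = x * f ^ i := by
          rw [← mul_assoc, ← ((show Commute x f from hf x).pow_right M).eq, mul_assoc, ← pow_add,
            Nat.add_sub_cancel' hM]
        rw [mul_add, this, add_assoc]
      · rw [hop.mul_left, ← hop.assoc]
        refine (hop.mono h3 (le_of_eq ?_)).trans hc
        rw [mul_left_comm, ← pow_add, Nat.add_sub_cancel' hM]

-- Replacing `r ^ i` by `N f ^ i` costs a factor `(N f / r) ^ i`. Hence small cost means small norm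
-- as long as the degree stays bounded.
omit hf in
lemma bound (hr : 0 < r) {D : ℕ} {b : A} {c : ℝ≥0} (h : Rep op N f r D b c) :
    N b ≤ c * (max 1 (N f / r)) ^ D := by
  induction h with
  | zero c => simp [hN.zero]
  | @add b c h i hi x c' hc ih =>
    calc N (b + x * f ^ i) ≤ op (N b) (N (x * f ^ i)) := hN.add _ _
      _ ≤ op (c * (max 1 (N f / r)) ^ D) (N x * r ^ i * (max 1 (N f / r)) ^ D) := by
        refine hop.mono ih ?_
        calc N (x * f ^ i) ≤ N x * N f ^ i := (hN.mul _ _).trans (by gcongr; exact hN.pow _ _)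
          _ = N x * r ^ i * (N f / r) ^ i := by
            rw [mul_assoc, ← mul_pow, mul_div_cancel₀ _ hr.ne']
          _ ≤ N x * r ^ i * (max 1 (N f / r)) ^ i := by gcongr; exact le_max_right _ _
          _ ≤ _ := by gcongr; exact le_max_left _ _
      _ ≤ _ := by rw [← hop.mul_right]; gcongr

/-- If `δ` is small both in the part `|f| ≤ r` and in the part `|f| ≥ r`, then it is topologically
nilpotent. -/
lemma nilpotent {d M : ℕ} {δ : A} {ε : ℝ≥0} (h1 : Rep op N f r d δ ε)
    (h2 : Rep op N f r M (f ^ M * δ) (ε * r ^ M)) (n : ℕ) :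
    Rep op N f r (M + d) (δ ^ n) (ε ^ n) := by
  induction n with
  | zero => simpa using (one hop hN).mono (Nat.zero_le _) le_rfl
  | succ n ih =>
    -- The factor `f ^ M` of the high-degree terms is absorbed into the next `δ`, where the second
    -- bound applies. This keeps the degree at most `M + d` for all `n`.
    obtain ⟨b₁, b₂, c₁, c₂, e, k1, k2, k3⟩ := ih.split hop hf M
    have e' : δ ^ (n + 1) = b₁ * δ + b₂ * (f ^ M * δ) := by
      rw [pow_succ, e, add_mul, ← mul_assoc b₂, ((show Commute b₂ f from hf b₂).pow_right M).eq]
    rw [e']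
    have m1 := k1.mul hop hN hf h1
    have m2 := (k2.mul hop hN hf h2).mono (by omega : M + d - M + M ≤ M + d) le_rfl
    refine (m1.add' hop m2).mono le_rfl ?_
    calc op (c₁ * ε) (c₂ * (ε * r ^ M)) = op c₁ (r ^ M * c₂) * ε := by
          rw [hop.mul_right]; congr 1; ring
      _ ≤ ε ^ (n + 1) := by rw [pow_succ]; gcongr

end Rep

/-! ### Approximate inverses and gluing. -/

/-- Iterating an approximate inverse. -/
lemma exists_iterate_inverse {g u e Q Q' : A} (hg : ∀ b, b * g = g * b) (h : u * e = g - Q)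
    (h' : e * u = g - Q') (n : ℕ) :
    Q ^ n * u = u * Q' ^ n ∧ ∀ en, u * en = g ^ n - Q ^ n → en * u = g ^ n - Q' ^ n →
      u * (g * en + e * Q ^ n) = g ^ (n + 1) - Q ^ (n + 1) ∧
      (g * en + e * Q ^ n) * u = g ^ (n + 1) - Q' ^ (n + 1) := by
  -- Both sides equal `g u - u e u`. Thus `u` intertwines the two errors, and a single sequence
  -- improves the inverse on both sides.
  have hQ : Q * u = u * Q' := by
    have e1 : Q = g - u * e := by rw [h]; abel
    have e2 : Q' = g - e * u := by rw [h']; abel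
    rw [e1, e2, sub_mul, mul_sub, hg, mul_assoc]
  have hQn : Q ^ n * u = u * Q' ^ n :=
    ((show SemiconjBy u Q' Q from hQ.symm).pow_right n).eq.symm
  refine ⟨hQn, fun en h1 h2 => ⟨?_, ?_⟩⟩
  · rw [mul_add, ← mul_assoc u g, hg, mul_assoc, h1, ← mul_assoc, h, pow_succ' g, pow_succ' Q]
    noncomm_ring
  · rw [add_mul, mul_assoc g, h2, mul_assoc e, hQn, ← mul_assoc, h', pow_succ' g, pow_succ' Q']
    noncomm_ring

lemma inv_of_pow {N : A → ℝ≥0} {u e : A} {n : ℕ} (h1 : N ((1 - u * e) ^ n) < 1)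
    (h2 : N ((1 - e * u) ^ n) < 1) : Inv N u := by
  have key : ∀ n : ℕ, ∃ en, u * en = 1 ^ n - (1 - u * e) ^ n ∧ en * u = 1 ^ n - (1 - e * u) ^ n := by
    intro n
    induction n with
    | zero => exact ⟨0, by simp⟩
    | succ n ih =>
      obtain ⟨en, k1, k2⟩ := ih
      exact ⟨_, (exists_iterate_inverse (g := 1) (e := e) (Q := 1 - u * e) (Q' := 1 - e * u)
        (by simp) (by simp) (by simp) n).2 en k1 k2⟩
  obtain ⟨en, k1, k2⟩ := key n
  exact ⟨en, by simpa [k1] using h1, by simpa [k2] using h2⟩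

section Gluing

variable {op : ℝ≥0 → ℝ≥0 → ℝ≥0} {N : A → ℝ≥0} {f : A} {r : ℝ≥0}

/-- Relative to `r ^ (M * n)`, the error decays like `θ ^ n` while the cost of the improved inverse
grows only linearly in `n`, so their product tends to `0`. The case `M = 0` serves `|f| ≤ r`, the
case `M = D` serves `|f| ≥ r`. -/
lemma exists_improved (hop : IsAgg op) (hN : IsSN op N) (hf : ∀ b, b * f = f * b) (hr : 0 < r)
    {u e : A} {M D : ℕ} (hMD : M ≤ D) {θ : ℝ≥0} (hθ : θ ≤ 1)
    (h : Rep op N f r D (f ^ M - u * e) (θ * r ^ M))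
    (h' : Rep op N f r D (f ^ M - e * u) (θ * r ^ M)) (n : ℕ) :
    ∃ en, Rep op N f r (D * n) (f ^ (M * n) - u * en) (θ ^ n * r ^ (M * n)) ∧
      Rep op N f r (D * n) (f ^ (M * n) - en * u) (θ ^ n * r ^ (M * n)) ∧
      Rep op N f r (D * n) en (N e / r ^ M * n * r ^ (M * n)) := by
  have hg : ∀ b, b * f ^ M = f ^ M * b := fun b => ((show Commute b f from hf b).pow_right M).eq
  have key : ∀ n : ℕ, ∃ en, u * en = (f ^ M) ^ n - (f ^ M - u * e) ^ n ∧
      en * u = (f ^ M) ^ n - (f ^ M - e * u) ^ n ∧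
      Rep op N f r (D * n) en (N e / r ^ M * n * r ^ (M * n)) := by
    intro n
    induction n with
    | zero => exact ⟨0, by simp, by simp, .zero _ _⟩
    | succ n ih =>
      obtain ⟨en, k1, k2, k3⟩ := ih
      obtain ⟨l1, l2⟩ := (exists_iterate_inverse (Q := f ^ M - u * e) (Q' := f ^ M - e * u)
        hg (by abel) (by abel) n).2 en k1 k2
      refine ⟨_, l1, l2, ?_⟩
      refine ((k3.pow_mul hop hN hf M).mono (by nlinarith : M + D * n ≤ D * (n + 1))
        le_rfl).add_le hop ((((h.pow hop hN hf n)).const_mul hop hN hf e).mono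
        (by nlinarith : D * n ≤ D * (n + 1)) le_rfl) ?_
      calc r ^ M * (N e / r ^ M * n * r ^ (M * n)) + N e * (θ * r ^ M) ^ n
          ≤ r ^ M * (N e / r ^ M * n * r ^ (M * n)) + N e * (1 * r ^ M) ^ n := by gcongr
        _ = N e / r ^ M * (n + 1) * r ^ (M * (n + 1)) := by
          rw [mul_add M, pow_add, one_mul, mul_one, pow_mul]
          field_simp
        _ = _ := by push_cast; ring
  obtain ⟨en, k1, k2, k3⟩ := key n
  refine ⟨en, ?_, ?_, k3⟩
  · rw [k1, pow_mul, sub_sub_cancel]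
    convert h.pow hop hN hf n using 1
    rw [mul_pow, pow_mul]
  · rw [k2, pow_mul, sub_sub_cancel]
    convert h'.pow hop hN hf n using 1
    rw [mul_pow, pow_mul]

/-- Invertibility in the parts `|f| ≤ r` and `|f| ≥ r` implies invertibility. -/
theorem inv_of_parts (hop : IsAgg op) (hN : IsSN op N) (hf : ∀ b, b * f = f * b) (hr : 0 < r)
    {u : A} {D : ℕ} {e : A} {θ : ℝ≥0} (hθ : θ < 1)
    (h1 : Rep op N f r D (1 - u * e) θ) (h1' : Rep op N f r D (1 - e * u) θ)
    {M : ℕ} {e' : A}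
    (h2 : Rep op N f r M (f ^ M - u * e') (θ * r ^ M))
    (h2' : Rep op N f r M (f ^ M - e' * u) (θ * r ^ M)) : Inv N u := by
  set κ₁ := N e / r ^ 0
  set κ₂ := N e' / r ^ M
  have hlim : Tendsto (fun n : ℕ => (θ : ℝ≥0) ^ n + N u * ((κ₁ + κ₂) * (n * θ ^ n))) atTop
      (𝓝 0) := by
    have t1 : Tendsto (fun n : ℕ => (θ : ℝ≥0) ^ n) atTop (𝓝 0) :=
      NNReal.tendsto_pow_atTop_nhds_zero_of_lt_one hθ
    have t2 : Tendsto (fun n : ℕ => (n : ℝ≥0) * θ ^ n) atTop (𝓝 0) := by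
      rw [← NNReal.tendsto_coe]
      push_cast
      exact tendsto_self_mul_const_pow_of_lt_one θ.2 (by exact_mod_cast hθ)
    simpa using t1.add ((t2.const_mul (κ₁ + κ₂)).const_mul (N u))
  obtain ⟨n, hn⟩ := (hlim.eventually_lt_const (show (0 : ℝ≥0) < 1 by norm_num)).exists
  set ε := (θ : ℝ≥0) ^ n + N u * ((κ₁ + κ₂) * (n * θ ^ n))
  obtain ⟨a, a1, a2, a3⟩ := exists_improved hop hN hf hr (Nat.zero_le D) hθ.le (u := u) (e := e)
    (by simpa using h1) (by simpa using h1') n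
  obtain ⟨b, b1, b2, b3⟩ := exists_improved hop hN hf hr le_rfl hθ.le h2 h2' n
  simp only [zero_mul, pow_zero, mul_one] at a1 a2 a3
  set η : ℝ≥0 := (κ₁ + κ₂) * (n * θ ^ n)
  set m := M * n
  have hcm : ∀ b, b * f ^ m = f ^ m * b := fun b => ((show Commute b f from hf b).pow_right m).eq
  -- On the overlap `a` and `f ^ (-m) b` are both approximate inverses of `u`, so their difference
  -- is small: each summand below pairs a linearly growing inverse with an error `θ ^ n`.
  have hW : Rep op N f r (D * n + m) (f ^ m * a - b) (η * r ^ m) := by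
    have e1 : f ^ m * a - b = a * (f ^ m - u * b) + -((1 - a * u) * b) := by
      rw [← hcm]; noncomm_ring
    rw [e1]
    refine (a3.mul hop hN hf b1).add_le hop ((a2.mul hop hN hf b3).neg hop hN hf) (le_of_eq ?_)
    simp only [η, κ₁, κ₂]
    ring
  -- The difference is distributed over the two parts: `a - w₂` on `|f| ≤ r` and `f ^ (-m) (b + w₁)`
  -- on `|f| ≥ r` now agree, so `a - w₂` is a global candidate.
  obtain ⟨w₁, w₂, c₁, c₂, hw, r1, r2, hc⟩ := hW.split hop hf m
  have hc1 : c₁ ≤ η * r ^ m := (hop.le_left _ _).trans hc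
  have hc2 : c₂ ≤ η := by
    have : r ^ m * c₂ ≤ r ^ m * η := ((hop.le_right _ _).trans hc).trans_eq (mul_comm _ _)
    exact le_of_mul_le_mul_left this (pow_pos hr m)
  have hfe : f ^ m * (a - w₂) = b + w₁ := by
    rw [mul_sub, ← sub_eq_iff_eq_add.2 hw]; abel
  -- Now `n` is fixed and only the power `k` grows, so the constant in `Rep.bound` does not depend
  -- on `k`.
  have small : ∀ δ : A, Rep op N f r (D * n + m) δ ε → Rep op N f r m (f ^ m * δ) (ε * r ^ m) →
      Tendsto (fun k : ℕ => N (δ ^ k)) atTop (𝓝 0) := by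
    intro δ d1 d2
    have hb : ∀ k : ℕ, N (δ ^ k) ≤ ε ^ k * (max 1 (N f / r)) ^ (m + (D * n + m)) := fun k =>
      (d1.nilpotent hop hN hf d2 k).bound hop hN hr
    have : Tendsto (fun k : ℕ => ε ^ k * (max 1 (N f / r)) ^ (m + (D * n + m))) atTop (𝓝 0) := by
      simpa using (NNReal.tendsto_pow_atTop_nhds_zero_of_lt_one hn).mul_const
        ((max 1 (N f / r)) ^ (m + (D * n + m)))
    exact tendsto_of_tendsto_of_tendsto_of_le_of_le tendsto_const_nhds this
      (fun _ => zero_le) hb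
  have s1 : Tendsto (fun k : ℕ => N ((1 - u * (a - w₂)) ^ k)) atTop (𝓝 0) := by
    refine small _ ?_ ?_
    · have e1 : 1 - u * (a - w₂) = (1 - u * a) + u * w₂ := by noncomm_ring
      rw [e1]
      refine (a1.mono (by omega) le_rfl).add_le hop
        ((r2.const_mul hop hN hf u).mono (by omega) le_rfl) ?_
      simp only [ε]; gcongr
    · have e1 : f ^ m * (1 - u * (a - w₂)) = (f ^ m - u * b) + -(u * w₁) := by
        rw [mul_sub, mul_one, ← mul_assoc, ← hcm, mul_assoc, hfe]; noncomm_ring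
      rw [e1]
      refine b1.add_le hop ((r1.const_mul hop hN hf u).neg hop hN hf) ?_
      calc _ ≤ θ ^ n * r ^ m + N u * (η * r ^ m) := by gcongr
        _ = _ := by simp only [ε, η]; ring
  have s2 : Tendsto (fun k : ℕ => N ((1 - (a - w₂) * u) ^ k)) atTop (𝓝 0) := by
    refine small _ ?_ ?_
    · have e1 : 1 - (a - w₂) * u = (1 - a * u) + w₂ * u := by noncomm_ring
      rw [e1]
      refine (a2.mono (by omega) le_rfl).add_le hop
        ((r2.mul_const hop hN hf u).mono (by omega) le_rfl) ?_
      simp only [ε]; rw [mul_comm c₂]; gcongr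
    · have e1 : f ^ m * (1 - (a - w₂) * u) = (f ^ m - b * u) + -(w₁ * u) := by
        rw [mul_sub, mul_one, ← mul_assoc, hfe]; noncomm_ring
      rw [e1]
      refine b2.add_le hop ((r1.mul_const hop hN hf u).neg hop hN hf) ?_
      calc _ ≤ θ ^ n * r ^ m + (η * r ^ m) * N u := by gcongr
        _ = _ := by simp only [ε, η]; ring
  obtain ⟨k, k1, k2⟩ := ((s1.eventually_lt_const (show (0 : ℝ≥0) < 1 by norm_num)).and
    (s2.eventually_lt_const (show (0 : ℝ≥0) < 1 by norm_num))).exists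
  exact inv_of_pow k1 k2

end Gluing

lemma nnreal_le_mul_of_forall_lt {x y z : ℝ≥0} (h : ∀ x', x < x' → ∀ y', y < y' → z ≤ x' * y') :
    z ≤ x * y := by
  rw [← NNReal.coe_le_coe, NNReal.coe_mul]
  refine le_mul_of_forall_lt₀ fun p hp q hq => ?_
  lift p to ℝ≥0 using x.2.trans hp.le
  lift q to ℝ≥0 using y.2.trans hq.le
  exact_mod_cast h p (by exact_mod_cast hp) q (by exact_mod_cast hq)

variable {A : Type*} [Ring A]

/-! ### Seminorms on the two parts of a central element. -/

section Parts

variable (op : ℝ≥0 → ℝ≥0 → ℝ≥0) (N : A → ℝ≥0) (f : A) (r : ℝ≥0)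

/-- The seminorm induced by `N` on the part `|f| ≤ r`. -/
noncomputable def innerPart (b : A) : ℝ≥0 := sInf {c | ∃ D, Rep op N f r D b c}

/-- The seminorm induced by `N` on the part `|f| ≥ r`. -/
noncomputable def outerPart (b : A) : ℝ≥0 :=
  sInf {c | ∃ M, Rep op N f r M (f ^ M * b) (c * r ^ M)}

variable {op N f r}

lemma innerPart_le {D : ℕ} {b : A} {c : ℝ≥0} (h : Rep op N f r D b c) :
    innerPart op N f r b ≤ c := csInf_le (OrderBot.bddBelow _) ⟨D, h⟩

lemma outerPart_le {M : ℕ} {b : A} {c : ℝ≥0} (h : Rep op N f r M (f ^ M * b) (c * r ^ M)) :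
    outerPart op N f r b ≤ c := csInf_le (OrderBot.bddBelow _) ⟨M, h⟩

variable (hop : IsAgg op)
include hop

lemma exists_of_innerPart_lt {b : A} {c : ℝ≥0} (h : innerPart op N f r b < c) :
    ∃ D, Rep op N f r D b c := by
  obtain ⟨c', ⟨D, hD⟩, hc⟩ := exists_lt_of_csInf_lt
    (s := {c | ∃ D, Rep op N f r D b c}) ⟨_, 0, Rep.const hop b⟩ h
  exact ⟨D, hD.mono le_rfl hc.le⟩

lemma innerPart_le_self (b : A) : innerPart op N f r b ≤ N b := innerPart_le (Rep.const hop b)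

lemma rep_self (b : A) : Rep op N f r 0 (f ^ 0 * b) (N b * r ^ 0) := by
  simpa using Rep.const hop b

lemma exists_of_outerPart_lt {b : A} {c : ℝ≥0} (h : outerPart op N f r b < c) :
    ∃ M, Rep op N f r M (f ^ M * b) (c * r ^ M) := by
  obtain ⟨c', ⟨D, hD⟩, hc⟩ := exists_lt_of_csInf_lt
    (s := {c | ∃ M, Rep op N f r M (f ^ M * b) (c * r ^ M)}) ⟨_, 0, rep_self hop b⟩ h
  exact ⟨D, hD.mono le_rfl (by gcongr)⟩

lemma outerPart_le_self (b : A) : outerPart op N f r b ≤ N b := outerPart_le (rep_self hop b)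

variable (hN : IsSN op N) (hf : ∀ b, b * f = f * b)
include hN hf

lemma isSN_innerPart : IsSN op (innerPart op N f r) where
  zero := le_antisymm (innerPart_le (Rep.zero 0 0)) zero_le
  one := (innerPart_le_self hop 1).trans hN.one
  neg := by
    have : ∀ x, innerPart op N f r (-x) ≤ innerPart op N f r x := fun x =>
      le_of_forall_gt fun c hc => lt_of_le_of_lt
        (innerPart_le ((exists_of_innerPart_lt hop (exists_between hc).choose_spec.1).choose_spec.neg
          hop hN hf)) (exists_between hc).choose_spec.2
    exact fun x => le_antisymm (this x) (by simpa using this (-x))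
  add x y := by
    refine hop.le_of_forall_lt fun c hc d hd => ?_
    obtain ⟨D, h1⟩ := exists_of_innerPart_lt hop hc
    obtain ⟨D', h2⟩ := exists_of_innerPart_lt hop hd
    exact innerPart_le ((h1.mono (le_max_left D D') le_rfl).add' hop
      (h2.mono (le_max_right D D') le_rfl))
  mul x y := by
    refine nnreal_le_mul_of_forall_lt fun c hc d hd => ?_
    obtain ⟨D, h1⟩ := exists_of_innerPart_lt hop hc
    obtain ⟨D', h2⟩ := exists_of_innerPart_lt hop hd
    exact innerPart_le (h1.mul hop hN hf h2)

lemma rep_outer_add {M : ℕ} {b : A} {c : ℝ≥0} (h : Rep op N f r M (f ^ M * b) (c * r ^ M))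
    (k : ℕ) : Rep op N f r (k + M) (f ^ (k + M) * b) (c * r ^ (k + M)) := by
  convert h.pow_mul hop hN hf k using 1
  · rw [pow_add, mul_assoc]
  · rw [pow_add]; ring

lemma isSN_outerPart : IsSN op (outerPart op N f r) where
  zero := le_antisymm (outerPart_le (M := 0) (by simpa using Rep.zero _ _)) zero_le
  one := (outerPart_le_self hop 1).trans hN.one
  neg := by
    have : ∀ x, outerPart op N f r (-x) ≤ outerPart op N f r x := fun x =>
      le_of_forall_gt fun c hc => lt_of_le_of_lt
        (outerPart_le (by
          rw [mul_neg]
          exact (exists_of_outerPart_lt hop (exists_between hc).choose_spec.1).choose_spec.neg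
            hop hN hf)) (exists_between hc).choose_spec.2
    exact fun x => le_antisymm (this x) (by simpa using this (-x))
  add x y := by
    refine hop.le_of_forall_lt fun c hc d hd => ?_
    obtain ⟨D, h1⟩ := exists_of_outerPart_lt hop hc
    obtain ⟨D', h2⟩ := exists_of_outerPart_lt hop hd
    refine outerPart_le (M := D' + D) ?_
    rw [mul_add, hop.mul_right]
    refine (rep_outer_add hop hN hf h1 D').add' hop ?_
    rw [add_comm D']
    exact rep_outer_add hop hN hf h2 D
  mul x y := by
    refine nnreal_le_mul_of_forall_lt fun c hc d hd => ?_
    obtain ⟨D, h1⟩ := exists_of_outerPart_lt hop hc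
    obtain ⟨D', h2⟩ := exists_of_outerPart_lt hop hd
    refine outerPart_le (M := D + D') ?_
    convert h1.mul hop hN hf h2 using 1
    · rw [mul_assoc (f ^ D), ← mul_assoc x, ((show Commute x f from hf x).pow_right D').eq,
        mul_assoc, ← mul_assoc (f ^ D), pow_add]
    · rw [pow_add]; ring

/-- Taken at `b = 1`, this shows that the inner part differs from a seminorm with `N 1 = 1` as soon
as `r < N f`. -/
lemma innerPart_mul_le (b : A) : innerPart op N f r (f * b) ≤ r * innerPart op N f r b := by
  refine nnreal_le_mul_of_forall_lt fun r' hr' c hc => ?_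
  obtain ⟨D, h⟩ := exists_of_innerPart_lt hop hc
  refine (innerPart_le (by simpa using h.pow_mul hop hN hf 1)).trans (by gcongr)

-- A representation for `f * b` with exponent `M` is one for `b` with exponent `M + 1`, cheaper by
-- the factor `r`. Multiplicativity of minimal seminorms comes from here.
omit hN hf in
lemma le_outerPart_mul (b : A) : r * outerPart op N f r b ≤ outerPart op N f r (f * b) := by
  refine le_of_forall_gt_imp_ge_of_dense fun c hc => ?_
  obtain ⟨M, h⟩ := exists_of_outerPart_lt hop hc
  rcases eq_or_ne r 0 with rfl | hr
  · simp
  have : outerPart op N f r b ≤ c / r := by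
    refine outerPart_le (M := M + 1) ?_
    rw [pow_succ f, mul_assoc]
    refine h.mono (Nat.le_succ _) (le_of_eq ?_)
    rw [pow_succ]; field_simp
  calc r * outerPart op N f r b ≤ r * (c / r) := by gcongr
    _ = c := mul_div_cancel₀ _ hr

/-- The outer data are a bare representation, so that they can also come from a fraction `c / q`,
with `M = 1`, in `exists_minimal_seminorm`. -/
lemma inv_of_inner_of_rep (hr : 0 < r) {u : A} (h1 : Inv (innerPart op N f r) u) {M : ℕ} {e : A}
    {θ : ℝ≥0} (hθ : θ < 1) (h2 : Rep op N f r M (f ^ M - u * e) (θ * r ^ M))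
    (h2' : Rep op N f r M (f ^ M - e * u) (θ * r ^ M)) : Inv N u := by
  obtain ⟨e', k1, k2⟩ := h1
  obtain ⟨t, ht, ht1⟩ := exists_between (max_lt k1 k2)
  obtain ⟨D, d1⟩ := exists_of_innerPart_lt hop ((le_max_left _ _).trans_lt ht)
  obtain ⟨D', d2⟩ := exists_of_innerPart_lt hop ((le_max_right _ _).trans_lt ht)
  have l1 : t ≤ max t θ := le_max_left _ _
  have l2 : θ ≤ max t θ := le_max_right _ _
  exact inv_of_parts hop hN hf hr (max_lt ht1 hθ) (d1.mono (le_max_left D D') l1)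
    (d2.mono (le_max_right D D') l1) (h2.mono le_rfl (by gcongr)) (h2'.mono le_rfl (by gcongr))

lemma inv_of_inner_of_outer (hr : 0 < r) {u : A} (h1 : Inv (innerPart op N f r) u)
    (h2 : Inv (outerPart op N f r) u) : Inv N u := by
  obtain ⟨e, k1, k2⟩ := h2
  obtain ⟨t, ht, ht1⟩ := exists_between (max_lt k1 k2)
  obtain ⟨D, d1⟩ := exists_of_outerPart_lt hop ((le_max_left _ _).trans_lt ht)
  obtain ⟨D', d2⟩ := exists_of_outerPart_lt hop ((le_max_right _ _).trans_lt ht)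
  have e1 := rep_outer_add hop hN hf d1 D'
  have e2 := rep_outer_add hop hN hf d2 D
  rw [add_comm D D'] at e2
  have hc : ∀ b, b * f ^ (D' + D) = f ^ (D' + D) * b := fun b =>
    ((show Commute b f from hf b).pow_right _).eq
  refine inv_of_inner_of_rep hop hN hf hr h1 (M := D' + D) ht1 (e := f ^ (D' + D) * e) ?_ ?_
  · convert e1 using 1
    rw [mul_sub, mul_one, ← mul_assoc, hc, mul_assoc]
  · convert e2 using 1
    rw [mul_sub, mul_one, mul_assoc]

end Parts

/-! ### Minimal seminorms. -/

/-- Among the seminorms below `N₀` for which `u` is not invertible there is one for which all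
central elements are multiplicative and for which `u` is not even invertible after inverting
central elements. -/
theorem exists_minimal_seminorm {op : ℝ≥0 → ℝ≥0 → ℝ≥0} (hop : IsAgg op) {N₀ : A → ℝ≥0}
    (h₀ : IsSN op N₀) {u : A} (hu : ¬ Inv N₀ u) :
    ∃ N : A → ℝ≥0, IsSN op N ∧ N ≤ N₀ ∧ N 1 = 1 ∧
      (∀ f, (∀ b, b * f = f * b) → ∀ b, N (f * b) = N f * N b) ∧
      ∀ q, (∀ b, b * q = q * b) → ∀ c, ¬ (N (q - u * c) < N q ∧ N (q - c * u) < N q) := by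
  -- Zorn's lemma is applied to the reversed order. The pointwise infimum of a chain stays in `S`:
  -- an approximate inverse for it needs two strict inequalities, which already hold at one member
  -- of the chain.
  let S : Set (A → ℝ≥0)ᵒᵈ := {N | IsSN op (OrderDual.ofDual N) ∧ ¬ Inv (OrderDual.ofDual N) u}
  obtain ⟨m, hm0, hm⟩ := zorn_le_nonempty₀ S (by
    intro c hcS hc N₁ hN₁
    have hdir : ∀ N ∈ c, ∀ N' ∈ c, ∃ L ∈ c, OrderDual.ofDual L ≤ OrderDual.ofDual N ∧
        OrderDual.ofDual L ≤ OrderDual.ofDual N' := by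
      intro N hN N' hN'
      rcases hc.total hN hN' with h | h
      · exact ⟨N', hN', h, le_rfl⟩
      · exact ⟨N, hN, le_rfl, h⟩
    let I : A → ℝ≥0 := fun x => sInf ((fun N : (A → ℝ≥0)ᵒᵈ => OrderDual.ofDual N x) '' c)
    have hIle : ∀ N ∈ c, ∀ x, I x ≤ OrderDual.ofDual N x := fun N hN x =>
      csInf_le (OrderBot.bddBelow _) ⟨N, hN, rfl⟩
    have hIlt : ∀ x t, I x < t → ∃ N ∈ c, OrderDual.ofDual N x < t := by
      intro x t h
      obtain ⟨_, ⟨N, hN, rfl⟩, h'⟩ := exists_lt_of_csInf_lt (Set.Nonempty.image _ ⟨N₁, hN₁⟩) h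
      exact ⟨N, hN, h'⟩
    refine ⟨OrderDual.toDual I, ⟨?_, ?_⟩, fun N hN => hIle N hN⟩
    · refine ⟨?_, ?_, ?_, ?_, ?_⟩
      · exact le_antisymm ((hIle N₁ hN₁ 0).trans (hcS hN₁).1.zero.le) zero_le
      · exact (hIle N₁ hN₁ 1).trans (hcS hN₁).1.one
      · intro x
        change sInf _ = sInf _
        congr 1
        exact Set.image_congr fun N hN => (hcS hN).1.neg x
      · intro x y
        refine hop.le_of_forall_lt fun s hs t ht => ?_
        obtain ⟨N, hN, h1⟩ := hIlt _ _ hs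
        obtain ⟨N', hN', h2⟩ := hIlt _ _ ht
        obtain ⟨L, hL, l1, l2⟩ := hdir N hN N' hN'
        exact (hIle L hL _).trans (((hcS hL).1.add x y).trans
          (hop.mono ((l1 x).trans h1.le) ((l2 y).trans h2.le)))
      · intro x y
        refine nnreal_le_mul_of_forall_lt fun s hs t ht => ?_
        obtain ⟨N, hN, h1⟩ := hIlt _ _ hs
        obtain ⟨N', hN', h2⟩ := hIlt _ _ ht
        obtain ⟨L, hL, l1, l2⟩ := hdir N hN N' hN'
        exact (hIle L hL _).trans (((hcS hL).1.mul x y).trans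
          (mul_le_mul' ((l1 x).trans h1.le) ((l2 y).trans h2.le)))
    · rintro ⟨e, k1, k2⟩
      obtain ⟨N, hN, h1⟩ := hIlt _ _ k1
      obtain ⟨N', hN', h2⟩ := hIlt _ _ k2
      obtain ⟨L, hL, l1, l2⟩ := hdir N hN N' hN'
      exact (hcS hL).2 ⟨e, (l1 _).trans_lt h1, (l2 _).trans_lt h2⟩) (OrderDual.toDual N₀) ⟨h₀, hu⟩
  set N : A → ℝ≥0 := OrderDual.ofDual m with hNdef
  have hN : IsSN op N := hm.prop.1
  have hNu : ¬ Inv N u := hm.prop.2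
  have hmin : ∀ N' : A → ℝ≥0, IsSN op N' → ¬ Inv N' u → N' ≤ N → N' = N := fun N' h1 h2 h3 =>
    le_antisymm h3 (hm.le_of_ge (y := OrderDual.toDual N') ⟨h1, h2⟩ h3)
  have hle : N ≤ N₀ := hm0
  have h1 : N 1 = 1 := by
    refine le_antisymm hN.one ?_
    have h0 : N 1 ≠ 0 := by
      intro h0
      refine hNu ⟨0, ?_, ?_⟩ <;> simp [h0]
    have := hN.mul 1 1
    rw [mul_one] at this
    exact le_of_mul_le_mul_left (by simpa using this) (pos_iff_ne_zero.2 h0)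
  have hcase : ∀ f, (∀ b, b * f = f * b) → ∀ r, 0 < r →
      innerPart op N f r = N ∨ outerPart op N f r = N := by
    intro f hf r hr
    by_cases hi : Inv (innerPart op N f r) u
    · right
      refine hmin _ (isSN_outerPart hop hN hf) (fun ho => ?_) fun b => outerPart_le_self hop b
      exact hNu (inv_of_inner_of_outer hop hN hf hr hi ho)
    · exact .inl (hmin _ (isSN_innerPart hop hN hf) hi fun b => innerPart_le_self hop b)
  have hin : ∀ f, (∀ b, b * f = f * b) → ∀ r, 0 < r → r < N f → innerPart op N f r ≠ N := by
    intro f hf r _ hrf h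
    have := innerPart_mul_le (r := r) hop hN hf 1
    rw [h, h1, mul_one, mul_one] at this
    exact absurd this (not_le.2 hrf)
  refine ⟨N, hN, hle, h1, fun f hf b => le_antisymm (hN.mul _ _) ?_, ?_⟩
  · refine NNReal.le_of_forall_lt_one_mul_le fun s hs => ?_
    rcases eq_or_ne (s * N f) 0 with h0 | h0
    · rw [← mul_assoc, h0]; simp
    -- The radius `s * N f` excludes the inner part, so `N` is the outer one, and `s * N f * N b ≤ N
    -- (f * b)` for every `s < 1`.
    have hlt : s * N f < N f :=
      mul_lt_of_lt_one_left (pos_iff_ne_zero.2 (right_ne_zero_of_mul h0)) hs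
    have := (hcase f hf _ (pos_iff_ne_zero.2 h0)).resolve_left
      (hin f hf _ (pos_iff_ne_zero.2 h0) hlt)
    have h2 := le_outerPart_mul (N := N) (f := f) (r := s * N f) hop b
    rw [this] at h2
    rwa [← mul_assoc]
  · rintro q hq c ⟨k1, k2⟩
    -- Since `r < N q`, minimality makes `u` invertible on `|q| ≤ r`; on `|q| ≥ r` the fraction `c /
    -- q` inverts `u` up to an error `t / r < 1`. Gluing contradicts the choice of `N`.
    obtain ⟨r, hr1, hr2⟩ := exists_between (max_lt k1 k2)
    obtain ⟨t, ht1, ht2⟩ := exists_between hr1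
    have hr : 0 < r := pos_of_gt hr1
    have hi : Inv (innerPart op N q r) u := by
      by_contra hi
      exact hin q hq r hr hr2 (hmin _ (isSN_innerPart hop hN hq) hi
        fun b => innerPart_le_self hop b)
    have e1 : t / r * r ^ 1 = t := by rw [pow_one, div_mul_cancel₀ _ hr.ne']
    refine hNu (inv_of_inner_of_rep hop hN hq hr hi (M := 1) (e := c) (θ := t / r)
      ((div_lt_one hr).2 ht2) ?_ ?_)
    · rw [e1, pow_one]
      exact (Rep.const hop _).mono zero_le_one ((le_max_left _ _).trans ht1.le)
    · rw [e1, pow_one]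
      exact (Rep.const hop _).mono zero_le_one ((le_max_right _ _).trans ht1.le)

/-! ### Spectral seminorms and their compactness. -/

section Spectral

variable {R : Type*} [NormedRing R]

/-- The image in `R[X]` of a polynomial with integer coefficients. -/
noncomputable abbrev intPoly (R : Type*) [Ring R] : ℤ[X] →+* R[X] := mapRingHom (Int.castRingHom R)

lemma intPoly_central {R : Type*} [Ring R] (q : ℤ[X]) (b : R[X]) :
    b * intPoly R q = intPoly R q * b := by
  induction q using Polynomial.induction_on' with
  | add p q hp hq => rw [map_add, mul_add, add_mul, hp, hq]
  | monomial n k =>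
    rw [← C_mul_X_pow_eq_monomial, map_mul, map_pow]
    simp only [coe_mapRingHom, map_X, eq_intCast, map_intCast]
    rw [mul_assoc, (commute_X_pow b n).eq, ← mul_assoc, ← mul_assoc, (Int.cast_commute k b).eq]

/-- The seminorms on `R[X]` that witness points of the spectrum of `a`. -/
structure IsSpectral (op : ℝ≥0 → ℝ≥0 → ℝ≥0) (a : R) (N : R[X] → ℝ≥0) : Prop where
  isSN : IsSN op N
  map_one : N 1 = 1
  map_C : ∀ r, N (C r) ≤ ‖r‖₊
  map_mul : ∀ (q : ℤ[X]) b, N (intPoly R q * b) = N (intPoly R q) * N b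
  not_inv : ∀ (q : ℤ[X]) c, ¬ (N (intPoly R q - (X - C a) * c) < N (intPoly R q) ∧
    N (intPoly R q - c * (X - C a)) < N (intPoly R q))

/-- Non-invertibility is used with `q = X` and `c = 1`, where both errors are `C a`. This bounds all
spectral seminorms pointwise. -/
lemma IsSpectral.map_X_le {op : ℝ≥0 → ℝ≥0 → ℝ≥0} {a : R} {N : R[X] → ℝ≥0}
    (h : IsSpectral op a N) : N X ≤ ‖a‖₊ := by
  by_contra! hlt
  refine h.not_inv X 1 ?_
  simpa using (h.map_C a).trans_lt hlt

lemma exists_bound_isSpectral {op : ℝ≥0 → ℝ≥0 → ℝ≥0} (hop : IsAgg op) (a : R) (p : R[X]) :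
    ∃ c : ℝ≥0, ∀ N, IsSpectral op a N → N p ≤ c := by
  induction p using Polynomial.induction_on' with
  | add p q hp hq =>
    obtain ⟨c, hc⟩ := hp
    obtain ⟨d, hd⟩ := hq
    exact ⟨c + d, fun N h => (h.isSN.add _ _).trans ((hop.le_add _ _).trans
      (add_le_add (hc N h) (hd N h)))⟩
  | monomial n r =>
    refine ⟨‖r‖₊ * ‖a‖₊ ^ n, fun N h => ?_⟩
    rw [← C_mul_X_pow_eq_monomial]
    exact (h.isSN.mul _ _).trans (mul_le_mul' (h.map_C r)
      ((h.isSN.pow _ _).trans (pow_le_pow_left₀ zero_le h.map_X_le n)))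

/-- The set lies in a product of compact intervals. It is closed because the negated strict
inequalities become a union of two closed conditions. -/
theorem isCompact_setOf_isSpectral {op : ℝ≥0 → ℝ≥0 → ℝ≥0} (hop : IsAgg op) (a : R) :
    IsCompact {N : R[X] → ℝ≥0 | IsSpectral op a N} := by
  choose c hc using exists_bound_isSpectral hop a
  refine (isCompact_univ_pi fun p => isCompact_Icc (a := (0 : ℝ≥0)) (b := c p)).of_isClosed_subset
    ?_ fun N hN p _ => ⟨zero_le, hc p N hN⟩
  have e : {N : R[X] → ℝ≥0 | IsSpectral op a N} =
      {N | N 0 = 0} ∩ {N | N 1 = 1} ∩ (⋂ x, {N | N (-x) = N x}) ∩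
      (⋂ x, ⋂ y, {N | N (x + y) ≤ op (N x) (N y)}) ∩ (⋂ x, ⋂ y, {N | N (x * y) ≤ N x * N y}) ∩
      (⋂ r, {N | N (C r) ≤ ‖r‖₊}) ∩
      (⋂ q, ⋂ b, {N | N (intPoly R q * b) = N (intPoly R q) * N b}) ∩
      (⋂ q, ⋂ c, ({N | N (intPoly R q) ≤ N (intPoly R q - (X - C a) * c)} ∪
        {N | N (intPoly R q) ≤ N (intPoly R q - c * (X - C a))})) := by
    ext N
    simp only [Set.mem_ofPred_eq, Set.mem_inter_iff, Set.mem_iInter, Set.mem_union]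
    constructor
    · intro h
      refine ⟨⟨⟨⟨⟨⟨⟨h.isSN.zero, h.map_one⟩, h.isSN.neg⟩, h.isSN.add⟩, h.isSN.mul⟩, h.map_C⟩,
        h.map_mul⟩, fun q c => ?_⟩
      have := h.not_inv q c
      rwa [not_and_or, not_lt, not_lt] at this
    · rintro ⟨⟨⟨⟨⟨⟨⟨h1, h2⟩, h3⟩, h4⟩, h5⟩, h6⟩, h7⟩, h8⟩
      refine ⟨⟨h1, h2.le, h3, h4, h5⟩, h2, h6, h7, fun q c => ?_⟩
      rw [not_and_or, not_lt, not_lt]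
      exact h8 q c
  rw [e]
  refine ((((((((isClosed_eq ?_ ?_).inter (isClosed_eq ?_ ?_)).inter ?_).inter ?_).inter ?_).inter
    ?_).inter ?_).inter ?_) <;> try fun_prop
  · exact isClosed_iInter fun x => isClosed_eq (by fun_prop) (by fun_prop)
  · exact isClosed_iInter fun x => isClosed_iInter fun y => isClosed_le (by fun_prop)
      (hop.continuous.comp (by fun_prop : Continuous fun N : R[X] → ℝ≥0 => (N x, N y)))
  · exact isClosed_iInter fun x => isClosed_iInter fun y =>
      isClosed_le (by fun_prop) (by fun_prop)
  · exact isClosed_iInter fun x => isClosed_le (by fun_prop) (by fun_prop)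
  · exact isClosed_iInter fun x => isClosed_iInter fun y =>
      isClosed_eq (by fun_prop) (by fun_prop)
  · exact isClosed_iInter fun x => isClosed_iInter fun y =>
      (isClosed_le (by fun_prop) (by fun_prop)).union (isClosed_le (by fun_prop) (by fun_prop))

/-- The point of the affine line under a spectral seminorm. -/
noncomputable def IsSpectral.toAffineLine {op : ℝ≥0 → ℝ≥0 → ℝ≥0} (hop : IsAgg op) {a : R}
    {N : R[X] → ℝ≥0} (h : IsSpectral op a N) : AffineLine :=
  show MulRingSeminorm ℤ[X] from
  { toFun := fun p => N (intPoly R p)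
    map_zero' := by simp [h.isSN.zero]
    add_le' := fun p q => by
      rw [map_add]; exact_mod_cast (h.isSN.add _ _).trans (hop.le_add _ _)
    neg' := fun p => by rw [map_neg, h.isSN.neg]
    map_one' := by simp [h.map_one]
    map_mul' := fun p q => by rw [_root_.map_mul, h.map_mul]; simp }

lemma isCompact_range_toAffineLine {op : ℝ≥0 → ℝ≥0 → ℝ≥0} (hop : IsAgg op) (a : R) :
    IsCompact (Set.range fun N : {N : R[X] → ℝ≥0 // IsSpectral op a N} =>
      N.2.toAffineLine hop) := by
  have : CompactSpace {N : R[X] → ℝ≥0 // IsSpectral op a N} :=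
    isCompact_iff_compactSpace.1 (isCompact_setOf_isSpectral hop a)
  refine isCompact_range (continuous_induced_rng.2 (continuous_pi fun p => ?_))
  exact NNReal.continuous_coe.comp ((continuous_apply (intPoly R p)).comp continuous_subtype_val)

end Spectral

/-! ### From points of the spectrum to spectral seminorms. -/

section Units

variable {B : Type*} [NormedRing B] [CompleteSpace B]

lemma isUnit_of_norm_one_sub_lt {u x y : B} (hx : ‖1 - u * x‖ < 1) (hy : ‖1 - y * u‖ < 1) :
    IsUnit u := by
  have h1 : IsUnit (u * x) := by
    have := isUnit_one_sub_of_norm_lt_one hx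
    rwa [sub_sub_cancel] at this
  have h2 : IsUnit (y * u) := by
    have := isUnit_one_sub_of_norm_lt_one hy
    rwa [sub_sub_cancel] at this
  obtain ⟨v, hv⟩ := h1
  obtain ⟨w, hw⟩ := h2
  have e1 : u * (x * (↑v⁻¹ : B)) = 1 := by rw [← mul_assoc, ← hv, Units.mul_inv]
  have e2 : (↑w⁻¹ * y : B) * u = 1 := by rw [mul_assoc, ← hw, Units.inv_mul]
  have e3 : (↑w⁻¹ * y : B) = x * (↑v⁻¹ : B) := by
    rw [← mul_one (↑w⁻¹ * y : B), ← e1, ← mul_assoc, e2, one_mul]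
  exact ⟨⟨u, _, e1, by rw [← e3, e2]⟩, rfl⟩

variable {R : Type*} [NormedRing R] {K : Type*} [NormedField K]

omit [CompleteSpace B] in
lemma norm_one_of_nontrivial [Nontrivial B] (f : K →+* B) (hf : ∀ k, ‖f k‖ ≤ ‖k‖) :
    ‖(1 : B)‖ = 1 := by
  refine le_antisymm (by simpa using hf 1) ?_
  have := norm_mul_le (1 : B) 1
  rw [mul_one] at this
  exact le_of_mul_le_mul_left ((mul_one _).trans_le this) (norm_pos_iff.2 one_ne_zero)

-- Contractivity at `k⁻¹` gives the reverse inequality, so a contractively embedded field scales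
-- norms exactly.
omit [CompleteSpace B] in
lemma norm_scalar_mul (g : K →+* B) (hg : ∀ k, ‖g k‖ ≤ ‖k‖) (k : K) (y : B) :
    ‖g k * y‖ = ‖k‖ * ‖y‖ := by
  refine le_antisymm ((norm_mul_le _ _).trans (by gcongr; exact hg k)) ?_
  rcases eq_or_ne k 0 with rfl | hk
  · simp
  have e : y = g k⁻¹ * (g k * y) := by rw [← mul_assoc, ← map_mul, inv_mul_cancel₀ hk]; simp
  have hp : 0 < ‖k‖ := norm_pos_iff.2 hk
  calc ‖k‖ * ‖y‖ ≤ ‖k‖ * (‖k⁻¹‖ * ‖g k * y‖) := by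
        conv_lhs => rw [e]
        gcongr
        exact (norm_mul_le _ _).trans (by gcongr; exact hg _)
    _ = ‖g k * y‖ := by rw [norm_inv, mul_inv_cancel_left₀ hp.ne']

/-- A scalar `s` for which `s - a` is not invertible yields a spectral seminorm. -/
theorem exists_isSpectral_of_not_isUnit {op : ℝ≥0 → ℝ≥0 → ℝ≥0}
    (hB : ∀ x y : B, ‖x + y‖₊ ≤ op ‖x‖₊ ‖y‖₊) (f : R →+* B) (g : K →+* B)
    (hf : ∀ r, ‖f r‖ ≤ ‖r‖) (hg : ∀ k, ‖g k‖ ≤ ‖k‖) (hfg : ∀ r k, Commute (f r) (g k))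
    {a : R} {s : K} (hu : ¬ IsUnit (g s - f a)) :
    ∃ N : R[X] → ℝ≥0, IsSpectral op a N ∧ ∀ q : ℤ[X], N (intPoly R q) = ‖aeval s q‖₊ := by
  have : Nontrivial B := by
    by_contra h
    rw [not_nontrivial_iff_subsingleton] at h
    exact hu (isUnit_of_subsingleton _)
  let Φ : R[X] →+* B := eval₂RingHom' f (g s) fun r => hfg r s
  have hC : ∀ r, Φ (C r) = f r := fun r => by simp [Φ]
  have hX : Φ X = g s := by simp [Φ]
  have hΦ : ∀ q : ℤ[X], Φ (intPoly R q) = g (aeval s q) := by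
    intro q
    have : Φ.comp (intPoly R) = g.comp (aeval s : ℤ[X] →ₐ[ℤ] K).toRingHom := by
      refine Polynomial.ringHom_ext' (RingHom.ext_int _ _) ?_
      simp [hX]
    exact congrArg (fun h : ℤ[X] →+* B => h q) this
  have hone := norm_one_of_nontrivial g hg
  have hq : ∀ q : ℤ[X], ‖Φ (intPoly R q)‖ = ‖aeval s q‖ := fun q => by
    rw [hΦ, ← mul_one (g _), norm_scalar_mul g hg, hone, mul_one]
  refine ⟨fun p => ‖Φ p‖₊, ⟨⟨by simp, ?_, by simp, ?_, ?_⟩, ?_, ?_, ?_, ?_⟩, fun q => ?_⟩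
  · rw [map_one]; exact_mod_cast hone.le
  · intro x y; rw [map_add]; exact hB _ _
  · intro x y; rw [map_mul]; exact nnnorm_mul_le _ _
  · rw [map_one]; exact NNReal.eq hone
  · intro r; rw [hC]; exact_mod_cast hf r
  · intro q b
    have h1 := norm_scalar_mul g hg (aeval s q) (Φ b)
    rw [← hΦ, ← hq, ← map_mul] at h1
    exact NNReal.eq h1
  · rintro q c ⟨h1, h2⟩
    have h1' : ‖Φ (intPoly R q - (X - C a) * c)‖ < ‖Φ (intPoly R q)‖ := h1
    have h2' : ‖Φ (intPoly R q - c * (X - C a))‖ < ‖Φ (intPoly R q)‖ := h2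
    rw [hq] at h1' h2'
    have hpos : 0 < ‖aeval s q‖ := (norm_nonneg _).trans_lt h1'
    have hne : aeval s q ≠ 0 := norm_pos_iff.1 hpos
    rw [map_sub, map_mul, map_sub, hX, hC, hΦ] at h1' h2'
    -- The scalar `q(s)` is non-zero, hence invertible, and dividing `Φ c` by it gives approximate
    -- inverses on both sides.
    refine hu (isUnit_of_norm_one_sub_lt (x := Φ c * g (aeval s q)⁻¹)
      (y := g (aeval s q)⁻¹ * Φ c) ?_ ?_)
    · have e : 1 - (g s - f a) * (Φ c * g (aeval s q)⁻¹) =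
          (g (aeval s q) - (g s - f a) * Φ c) * g (aeval s q)⁻¹ := by
        rw [sub_mul (g (aeval s q)), ← map_mul, mul_inv_cancel₀ hne, map_one, mul_assoc]
      rw [e]
      calc _ ≤ ‖g (aeval s q) - (g s - f a) * Φ c‖ * ‖(aeval s q)⁻¹‖ :=
            (norm_mul_le _ _).trans (by gcongr; exact hg _)
        _ < ‖aeval s q‖ * ‖(aeval s q)⁻¹‖ := by gcongr; simpa using hne
        _ = 1 := by rw [norm_inv, mul_inv_cancel₀ hpos.ne']
    · have e : 1 - (g (aeval s q)⁻¹ * Φ c) * (g s - f a) =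
          g (aeval s q)⁻¹ * (g (aeval s q) - Φ c * (g s - f a)) := by
        rw [mul_sub (g (aeval s q)⁻¹), ← map_mul, inv_mul_cancel₀ hne, map_one, mul_assoc]
      rw [e]
      calc _ ≤ ‖(aeval s q)⁻¹‖ * ‖g (aeval s q) - Φ c * (g s - f a)‖ :=
            (norm_mul_le _ _).trans (by gcongr; exact hg _)
        _ < ‖(aeval s q)⁻¹‖ * ‖aeval s q‖ := by gcongr; simpa using hne
        _ = 1 := by rw [norm_inv, inv_mul_cancel₀ hpos.ne']
  · exact NNReal.eq (hq q)

end Units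

/-! ### From spectral seminorms back to points. -/

section Localization

variable {S₀ : Type w} [CommRing S₀] {A : Type u} [Ring A] [Algebra S₀ A]

/-- The elements of `S₀` at which a seminorm that is multiplicative on `S₀` does not vanish. -/
def nonvanishing (N : A → ℝ≥0) (h1 : N 1 = 1)
    (hmul : ∀ (q : S₀) b, N (algebraMap S₀ A q * b) = N (algebraMap S₀ A q) * N b) :
    Submonoid S₀ where
  carrier := {q | N (algebraMap S₀ A q) ≠ 0}
  one_mem' := by simp [h1]
  mul_mem' {p q} hp hq := by
    change N _ ≠ 0
    rw [map_mul, hmul]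
    exact mul_ne_zero hp hq

/-- A ring with a seminorm that is multiplicative on a central subring maps isometrically to a
Banach ring in which the elements of the subring of non-zero norm become invertible. -/
theorem exists_localization {op : ℝ≥0 → ℝ≥0 → ℝ≥0} (hop : IsAgg op) {N : A → ℝ≥0}
    (hN : IsSN op N) (h1 : N 1 = 1)
    (hmul : ∀ (q : S₀) b, N (algebraMap S₀ A q * b) = N (algebraMap S₀ A q) * N b) :
    ∃ (B : Type (max u w)) (_ : NormedRing B) (_ : CompleteSpace B) (j : A →+* B)
      (κ : Localization (nonvanishing N h1 hmul) →+* B),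
      (∀ x y : B, ‖x + y‖₊ ≤ op ‖x‖₊ ‖y‖₊) ∧ (∀ z, ‖j z‖₊ = N z) ∧
      (∀ q, κ (algebraMap _ _ q) = j (algebraMap S₀ A q)) ∧
      (∀ x y, Commute (κ x) y) ∧ (∀ x y, ‖κ x * y‖ = ‖κ x‖ * ‖y‖) ∧ (∀ x, κ x ≠ 0 → IsUnit x) ∧
      ∀ (y : B) (ε : ℝ), 0 < ε → ∃ q z, N (algebraMap S₀ A q) ≠ 0 ∧
        ‖j (algebraMap S₀ A q) * y - j z‖ < ε * N (algebraMap S₀ A q) := by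
  set S := nonvanishing N h1 hmul with hS
  have hsmul : ∀ (s : S₀) (m : A), N (s • m) = N (algebraMap S₀ A s) * N m := fun s m => by
    rw [Algebra.smul_def, hmul]
  have hsmul' : ∀ (s : S) (m : A), N (s • m) = N (algebraMap S₀ A s) * N m := fun s m =>
    hsmul s m
  have hs0 : ∀ s : S, N (algebraMap S₀ A s) ≠ 0 := fun s => s.2
  -- The quotient of norms is well defined because `N` is multiplicative along the denominators.
  let n : LocalizedModule S A → ℝ≥0 := fun x =>
    x.liftOn (fun p => N p.1 / N (algebraMap S₀ A p.2)) (by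
      rintro ⟨m, s⟩ ⟨m', s'⟩ h
      obtain ⟨t, ht⟩ := h
      have := congrArg N ht
      simp only [hsmul'] at this
      have h2 := mul_left_cancel₀ (hs0 t) this
      change N m / _ = N m' / _
      rw [div_eq_div_iff (hs0 s) (hs0 s'), mul_comm, h2, mul_comm])
  have hn : ∀ m s, n (LocalizedModule.mk m s) = N m / N (algebraMap S₀ A s) := fun m s =>
    LocalizedModule.liftOn_mk _ _ _
  have hnadd : ∀ x y, n (x + y) ≤ op (n x) (n y) := by
    intro x y
    induction x, y using LocalizedModule.induction_on₂ with
    | h m m' s s' =>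
      rw [LocalizedModule.mk_add_mk, hn, hn, hn, Submonoid.coe_mul, map_mul, hmul,
        div_le_iff₀ (pos_iff_ne_zero.2 (mul_ne_zero (hs0 s) (hs0 s'))), hop.mul_right]
      refine (hN.add _ _).trans (le_of_eq ?_)
      rw [hsmul', hsmul']
      have := hs0 s
      have := hs0 s'
      congr 1 <;> field_simp
  have hnmul : ∀ x y, n (x * y) ≤ n x * n y := by
    intro x y
    induction x, y using LocalizedModule.induction_on₂ with
    | h m m' s s' =>
      rw [LocalizedModule.mk_mul_mk, hn, hn, hn, Submonoid.coe_mul, map_mul, hmul,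
        div_mul_div_comm]
      gcongr
      exact hN.mul _ _
  have hnneg : ∀ x, n (-x) = n x := by
    intro x
    induction x using LocalizedModule.induction_on with
    | h m s => rw [← LocalizedModule.mk_neg, hn, hn, hN.neg]
  let ρ : RingSeminorm (LocalizedModule S A) :=
    { toFun := fun x => n x
      map_zero' := by
        rw [← LocalizedModule.zero_mk (1 : S), hn, hN.zero]; simp
      add_le' := fun x y => by exact_mod_cast (hnadd x y).trans (hop.le_add _ _)
      neg' := fun x => by rw [hnneg]
      mul_le' := fun x y => by exact_mod_cast hnmul x y }
  let _ : SeminormedRing (LocalizedModule S A) := ρ.toSeminormedRing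
  have hnorm : ∀ x : LocalizedModule S A, ‖x‖₊ = n x := fun x => rfl
  have hnorm' : ∀ x : LocalizedModule S A, ‖x‖ = n x := fun x => rfl
  let _ : Algebra (Localization S) (LocalizedModule S A) :=
    LocalizedModule.algebraOfIsLocalization _
  let κ₀ : Localization S →+* LocalizedModule S A := algebraMap _ _
  have hκ₀ : ∀ p s, κ₀ (Localization.mk p s) = LocalizedModule.mk (algebraMap S₀ A p) s :=
    fun p s => LocalizedModule.algebraMap_mk p s
  let c := UniformSpace.Completion.coeRingHom (α := LocalizedModule S A)
  have hc : ∀ x, ‖c x‖ = n x := fun x => UniformSpace.Completion.norm_coe x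
  have hc' : ∀ x, ‖c x‖₊ = n x := fun x => UniformSpace.Completion.nnnorm_coe x
  let num : A →+* LocalizedModule S A := LocalizedModule.numeratorRingHom
  have hnum : ∀ z, num z = LocalizedModule.mk z 1 := fun z => rfl
  have hnn : ∀ z, n (num z) = N z := fun z => by rw [hnum, hn]; simp [h1]
  have hmul0 : ∀ x y, n (κ₀ x * y) = n (κ₀ x) * n y := by
    intro x y
    induction x using Localization.induction_on with | _ x => _
    induction y using LocalizedModule.induction_on with | _ m s => _
    obtain ⟨p, t⟩ := x
    rw [hκ₀, LocalizedModule.mk_mul_mk, hn, hn, hn, Submonoid.coe_mul, map_mul, hmul, hmul,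
      div_mul_div_comm]
  refine ⟨UniformSpace.Completion (LocalizedModule S A), inferInstance, inferInstance,
    c.comp num, c.comp κ₀, ?_, ?_, ?_, ?_, ?_, ?_, ?_⟩
  · intro x y
    refine UniformSpace.Completion.induction_on₂ x y ?_ ?_
    · exact isClosed_le (by fun_prop) (hop.continuous.comp (by fun_prop :
        Continuous fun p : UniformSpace.Completion (LocalizedModule S A) ×
          UniformSpace.Completion (LocalizedModule S A) => (‖p.1‖₊, ‖p.2‖₊)))
    · intro x y
      have := hnadd x y
      rw [← hc', ← hc', ← hc', map_add] at this
      exact this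
  · intro z
    rw [RingHom.comp_apply, hc', hnn]
  · intro q
    rw [RingHom.comp_apply, RingHom.comp_apply, ← Localization.mk_one_eq_algebraMap, hκ₀, hnum]
  · intro x y
    refine UniformSpace.Completion.induction_on y ?_ fun y => ?_
    · exact isClosed_eq (by fun_prop) (by fun_prop)
    · exact ((show Commute (κ₀ x) y from Algebra.commutes x y).map c)
  · intro x y
    refine UniformSpace.Completion.induction_on y ?_ fun y => ?_
    · exact isClosed_eq (by fun_prop) (by fun_prop)
    · change ‖c (κ₀ x) * c y‖ = ‖c (κ₀ x)‖ * ‖c y‖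
      rw [← map_mul, hc, hc, hc, hmul0]; simp
  · intro x hx
    induction x using Localization.induction_on with | _ x => _
    obtain ⟨p, t⟩ := x
    -- A fraction with non-zero image has a numerator of non-zero norm, which is therefore an
    -- admissible denominator.
    have hp : p ∈ S := by
      intro h0
      refine hx (norm_eq_zero.1 ?_)
      rw [RingHom.comp_apply, hc, hκ₀, hn, h0]; simp
    refine IsUnit.of_mul_eq_one (Localization.mk t ⟨p, hp⟩) ?_
    rw [Localization.mk_mul]
    convert Localization.mk_self (t * ⟨p, hp⟩ : S) using 2
    exact mul_comm _ _
  · intro y ε hε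
    obtain ⟨_, hx, x, rfl⟩ := Metric.dense_iff.1
      (UniformSpace.Completion.denseRange_coe (α := LocalizedModule S A)) y ε hε
    induction x using LocalizedModule.induction_on with | _ z s => _
    refine ⟨s, z, hs0 s, ?_⟩
    have e : num (algebraMap S₀ A s) * LocalizedModule.mk z s = num z := by
      rw [hnum, hnum, LocalizedModule.mk_mul_mk, ← Algebra.smul_def, one_mul]
      exact LocalizedModule.mk_cancel s z
    have e' : c (num (algebraMap S₀ A s)) * y - c (num z) =
        c (num (algebraMap S₀ A s)) * (y - c (LocalizedModule.mk z s)) := by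
      rw [mul_sub, ← map_mul, e]
    rw [RingHom.comp_apply, RingHom.comp_apply, e']
    refine (norm_mul_le _ _).trans_lt ?_
    rw [hc, hnn, mul_comm]
    have hx' : ‖y - c (LocalizedModule.mk z s)‖ < ε := by
      rw [← dist_eq_norm, dist_comm]; exact hx
    gcongr
    exact_mod_cast pos_iff_ne_zero.2 (hs0 s)

end Localization

/-- A complete normed field embedded in `ℕ → ℕ` has a model in any universe. -/
lemma exists_valField_model {K : Type u} [NormedField K] [CompleteSpace K] {t : K → ℕ → ℕ}
    (ht : Function.Injective t) (α : Cardinal.{v}) (hα : Cardinal.aleph0 ≤ α) :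
    ∃ (F : ValField α) (e : F ≃+* K), ∀ x, ‖e x‖ = ‖x‖ := by
  have : Small.{v} K := small_of_injective ht
  let e : Shrink.{v} K ≃+* K := Shrink.ringEquiv K
  let nf : NormedField (Shrink.{v} K) := NormedField.induced (Shrink.{v} K) K e e.injective
  have hn : ∀ x : Shrink.{v} K, ‖e x‖ = ‖x‖ := fun x => rfl
  have hiso : Isometry e := AddMonoidHomClass.isometry_of_norm e hn
  have hcomp : CompleteSpace (Shrink.{v} K) :=
    (hiso.isUniformInducing.completeSpace_congr e.surjective).2 inferInstance
  have hcard : Cardinal.mk (Shrink.{v} K) ≤ 2 ^ α := by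
    have h := Cardinal.lift_mk_le_lift_mk_of_injective (ht.comp e.injective)
    have h2 : Cardinal.lift.{v} (Cardinal.mk (ℕ → ℕ)) = 2 ^ Cardinal.aleph0.{v} := by simp
    rw [h2, Cardinal.lift_uzero] at h
    exact h.trans (Cardinal.power_le_power_left two_ne_zero hα)
  exact ⟨⟨Shrink.{v} K, hcard⟩, e, hn⟩

/-- The closure of a central multiplicatively normed "fraction field" in a Banach ring is a complete
valuation field. -/
theorem exists_valField {B : Type u} [NormedRing B] [CompleteSpace B] [Nontrivial B] {L : Type w}
    [CommRing L] [Countable L] (κ : L →+* B) (hcomm : ∀ x y, Commute (κ x) y)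
    (hmul : ∀ x y, ‖κ x * y‖ = ‖κ x‖ * ‖y‖) (hinv : ∀ x, κ x ≠ 0 → IsUnit x)
    (α : Cardinal.{v}) (hα : Cardinal.aleph0 ≤ α) :
    ∃ (K : ValField α) (g : K →+* B) (i : L →+* K), (∀ k, ‖g k‖ = ‖k‖) ∧
      (∀ k y, Commute (g k) y) ∧ ∀ x, g (i x) = κ x := by
  let K : Subring B := κ.range.topologicalClosure
  have hK : IsClosed (K : Set B) := κ.range.isClosed_topologicalClosure
  have hcoe : (K : Set B) = closure (Set.range κ) := by
    rw [← RingHom.coe_range]; rfl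
  have hmem : ∀ k : K, (k : B) ∈ closure (Set.range κ) := fun k => hcoe ▸ k.2
  have hcommK : ∀ (k : K) (y : B), Commute (k : B) y := fun k y =>
    closure_minimal (s := Set.range κ) (t := {x | x * y = y * x})
      (by rintro _ ⟨x, rfl⟩; exact hcomm x y)
      (isClosed_eq (by fun_prop) (by fun_prop)) (hmem k)
  have hmulK : ∀ (k : K) (y : B), ‖(k : B) * y‖ = ‖(k : B)‖ * ‖y‖ := fun k y =>
    closure_minimal (s := Set.range κ) (t := {x | ‖x * y‖ = ‖x‖ * ‖y‖})
      (by rintro _ ⟨x, rfl⟩; exact hmul x y)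
      (isClosed_eq (by fun_prop) (by fun_prop)) (hmem k)
  have hKc : CompleteSpace K := hK.completeSpace_coe
  have hunit : ∀ k : K, k ≠ 0 → IsUnit k := by
    intro k hk
    have hpos : 0 < ‖(k : B)‖ := norm_pos_iff.2 (by simpa using hk)
    -- A fraction within `‖k‖ / 2` of `k` has norm above `‖k‖ / 2`. It is thus invertible, and `k`
    -- divided by it is within distance less than `1` of `1`.
    obtain ⟨_, ⟨x, rfl⟩, hx⟩ := Metric.mem_closure_iff.1 (hmem k) _ (half_pos hpos)
    rw [dist_eq_norm] at hx
    have hxn : ‖(k : B)‖ / 2 < ‖κ x‖ := by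
      have := norm_sub_norm_le (k : B) (κ x)
      linarith
    obtain ⟨w, rfl⟩ := hinv x (norm_pos_iff.1 ((half_pos hpos).trans hxn))
    let i : L →+* K := (Subring.inclusion κ.range.le_topologicalClosure).comp κ.rangeRestrict
    have hi : ∀ x, (i x : B) = κ x := fun x => rfl
    have h1 : ‖1 - i (↑w⁻¹) * k‖ < 1 := by
      have e : ((i w * (1 - i (↑w⁻¹) * k) : K) : B) = κ w - k := by
        rw [mul_sub, ← mul_assoc, ← map_mul, Units.mul_inv, map_one, mul_one, one_mul]
        simp [hi]
      have e2 : ‖κ w‖ * ‖1 - i (↑w⁻¹) * k‖ = ‖κ w - k‖ := by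
        rw [← e, Subring.coe_mul, hi, hmul]; rfl
      rw [norm_sub_rev] at hx
      have : ‖κ w‖ * ‖1 - i (↑w⁻¹) * k‖ < ‖κ w‖ * 1 := by rw [e2, mul_one]; linarith
      exact lt_of_mul_lt_mul_left this (norm_nonneg _)
    have h2 := isUnit_one_sub_of_norm_lt_one h1
    rw [sub_sub_cancel] at h2
    have h3 : IsUnit (i w * (i (↑w⁻¹) * k)) := (w.isUnit.map i).mul h2
    rwa [← mul_assoc, ← map_mul, Units.mul_inv, map_one, one_mul] at h3
  have hcK : ∀ x y : K, x * y = y * x := fun x y => Subtype.ext (hcommK x y)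
  have hfield : IsField K :=
    { exists_pair_ne := ⟨0, 1, zero_ne_one⟩
      mul_comm := hcK
      mul_inv_cancel := fun {x} hx => by
        obtain ⟨w, rfl⟩ := hunit x hx
        exact ⟨_, w.mul_inv⟩ }
  let nf : NormedField K :=
    { hfield.toField, (inferInstance : NormedRing K) with
      dist_eq := fun x y => NormedRing.dist_eq x y
      norm_mul := fun x y => hmulK x y }
  obtain ⟨τ, hτ⟩ := Countable.exists_injective_nat L
  have hseq : ∀ k : K, ∃ s : ℕ → L, Tendsto (fun n => κ (s n)) atTop (𝓝 (k : B)) := by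
    intro k
    obtain ⟨y, hy, hy'⟩ := mem_closure_iff_seq_limit.1 (hmem k)
    choose s hs using hy
    exact ⟨s, by simpa [hs] using hy'⟩
  choose s hs using hseq
  -- A sequence in the countable ring `L` determines its limit, which embeds `K` in `ℕ → ℕ`. This
  -- bounds the cardinality and allows the change of universe.
  have hinj : Function.Injective fun (k : K) n => τ (s k n) := by
    intro k k' h
    have : s k = s k' := funext fun n => hτ (congrFun h n)
    have h1 := hs k
    rw [this] at h1
    exact Subtype.ext (tendsto_nhds_unique h1 (hs k'))
  obtain ⟨F, e, he⟩ := exists_valField_model (K := K) hinj α hα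
  let i : L →+* K := (Subring.inclusion κ.range.le_topologicalClosure).comp κ.rangeRestrict
  refine ⟨F, K.subtype.comp (e : F →+* K), (e.symm : K →+* F).comp i, fun k => he k,
    fun k y => hcommK (e k) y, fun x => ?_⟩
  change ((e (e.symm (i x)) : K) : B) = κ x
  rw [e.apply_symm_apply]
  rfl

/-- A spectral seminorm comes from a scalar `s` for which `s - a` is not invertible. -/
theorem IsSpectral.exists_scalar {R : Type u} [NormedRing R] {op : ℝ≥0 → ℝ≥0 → ℝ≥0}
    (hop : IsAgg op) {a : R} {N : R[X] → ℝ≥0} (h : IsSpectral op a N)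
    (α : Cardinal.{v}) (hα : Cardinal.aleph0 ≤ α) :
    ∃ (B : Type u) (_ : NormedRing B) (_ : CompleteSpace B) (K : ValField α) (s : K)
      (f : R →+* B) (g : K →+* B), (∀ x y : B, ‖x + y‖₊ ≤ op ‖x‖₊ ‖y‖₊) ∧ (∀ r, ‖f r‖ ≤ ‖r‖) ∧
      (∀ k, ‖g k‖ ≤ ‖k‖) ∧ (∀ r k, Commute (f r) (g k)) ∧ ¬ IsUnit (g s - f a) ∧
      ∀ q : ℤ[X], N (intPoly R q) = ‖aeval s q‖₊ := by
  let _ : Algebra ℤ[X] R[X] := (intPoly R).toAlgebra' fun q b => (intPoly_central q b).symm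
  obtain ⟨B, _, _, j, κ, hadd, hj, hκj, hcomm, hmul, hinv, hdense⟩ :=
    exists_localization (S₀ := ℤ[X]) hop h.isSN h.map_one h.map_mul
  have hj' : ∀ z, ‖j z‖ = N z := fun z => congrArg NNReal.toReal (hj z)
  have hone : ‖(1 : B)‖ = 1 := by rw [← _root_.map_one j, hj', h.map_one]; rfl
  have : Nontrivial B := ⟨1, 0, fun h0 => by simp [h0] at hone⟩
  have : Countable (Localization (nonvanishing (S₀ := ℤ[X]) N h.map_one h.map_mul)) := by
    have : Countable ℤ[X] :=
      Cardinal.mk_le_aleph0_iff.1 (Polynomial.cardinalMk_le_max.trans (by simp))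
    refine Function.Surjective.countable (f := fun p :
      ℤ[X] × nonvanishing (S₀ := ℤ[X]) N h.map_one h.map_mul => Localization.mk p.1 p.2) ?_
    intro x
    induction x using Localization.induction_on with | _ x => _
    exact ⟨x, rfl⟩
  obtain ⟨K, g, i, hg, hgc, hi⟩ := exists_valField κ hcomm hmul hinv α hα
  let s : K := i (algebraMap _ _ (X : ℤ[X]))
  have hgs : ∀ q : ℤ[X], g (aeval s q) = j (intPoly R q) := by
    intro q
    have e : g.comp (aeval s : ℤ[X] →ₐ[ℤ] K).toRingHom = j.comp (intPoly R) := by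
      refine Polynomial.ringHom_ext' (RingHom.ext_int _ _) ?_
      simp only [AlgHom.toRingHom_eq_coe, RingHom.coe_comp, RingHom.coe_coe, Function.comp_apply,
        aeval_X, s, hi, hκj]
      rfl
    exact congrArg (fun h : ℤ[X] →+* B => h q) e
  have hgX : g s = j X := by simpa using hgs X
  have hu : g s - j (C a) = j (X - C a) := by rw [hgX, map_sub]
  refine ⟨B, inferInstance, inferInstance, K, s, j.comp C, g, hadd, fun r => ?_,
    fun k => (hg k).le, fun r k => (hgc k _).symm, ?_, fun q => ?_⟩
  · rw [RingHom.comp_apply, hj']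
    exact_mod_cast h.map_C r
  · rw [RingHom.comp_apply, hu]
    rintro ⟨w, hw⟩
    set u : R[X] := X - C a
    -- If `u` had an inverse, a fraction `z / q` this close to it would violate `not_inv`, as `N u /
    -- (N u + 1) < 1`.
    obtain ⟨q, z, hq, hz⟩ := hdense (↑w⁻¹ : B) (1 / (N u + 1)) (by positivity)
    have hqpos : (0 : ℝ) < N (intPoly R q) := by exact_mod_cast pos_iff_ne_zero.2 hq
    have hlt : (N u : ℝ) * (1 / (N u + 1) * N (intPoly R q)) < N (intPoly R q) := by
      rw [← mul_assoc, mul_one_div]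
      have : (N u : ℝ) / (N u + 1) < 1 := by
        rw [div_lt_one (by positivity)]; linarith
      exact mul_lt_of_lt_one_left hqpos this
    have hcq : Commute (j (intPoly R q)) (j u) := 
      (show Commute (intPoly R q) u from (intPoly_central q u).symm).map j
    refine h.not_inv q z ⟨?_, ?_⟩
    · rw [← NNReal.coe_lt_coe, ← hj']
      have e : j (intPoly R q - u * z) = j u * (j (intPoly R q) * ↑w⁻¹ - j z) := by
        rw [mul_sub, ← mul_assoc, ← hcq.eq, mul_assoc, ← hw, Units.mul_inv, mul_one, hw,
          map_sub, _root_.map_mul]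
      rw [e]
      refine ((norm_mul_le _ _).trans ?_).trans_lt hlt
      rw [hj']
      gcongr
      exact hz.le
    · rw [← NNReal.coe_lt_coe, ← hj']
      have e : j (intPoly R q - z * u) = (j (intPoly R q) * ↑w⁻¹ - j z) * j u := by
        rw [sub_mul, mul_assoc, ← hw, Units.inv_mul, mul_one, hw, map_sub, _root_.map_mul]
      rw [e]
      refine ((norm_mul_le _ _).trans ?_).trans_lt hlt
      rw [hj', mul_comm]
      gcongr
      exact hz.le
  · refine NNReal.eq ?_
    rw [coe_nnnorm, ← hj', ← hgs, hg]

/-! ### Universal property of the completed tensor products. -/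

section TensorMaps

variable {R : Type u} {S : Type v} [NormedRing R] [NormedRing S]

variable (R S) in
/-- The identity of `R ⊗ S`, with the projective seminorm on the target. -/
def toProj : R ⊗[ℤ] S →+* ProjTensor R S := RingHom.id (R ⊗[ℤ] S)

variable (R S) in
/-- The identity of `R ⊗ S`, with the ultrametric projective seminorm on the target. -/
def toUm : R ⊗[ℤ] S →+* UmTensor R S := RingHom.id (R ⊗[ℤ] S)

lemma norm_toProj_sum_le {ι : Type*} [Fintype ι] (a : ι → R) (b : ι → S) :
    ‖toProj R S (∑ k, a k ⊗ₜ[ℤ] b k)‖ ≤ ∑ k, ‖a k‖ * ‖b k‖ :=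
  sInf_projCosts_le a b

lemma norm_toUm_sum_le {ι : Type*} [Fintype ι] (a : ι → R) (b : ι → S) {c : ℝ} (hc : 0 ≤ c)
    (h : ∀ k, ‖a k‖ * ‖b k‖ ≤ c) : ‖toUm R S (∑ k, a k ⊗ₜ[ℤ] b k)‖ ≤ c :=
  sInf_umCosts_le a b hc h

lemma exists_of_norm_projTensor_lt {z : ProjTensor R S} {c : ℝ} (h : ‖z‖ < c) :
    ∃ (n : ℕ) (a : Fin n → R) (b : Fin n → S),
      z = toProj R S (∑ k, a k ⊗ₜ[ℤ] b k) ∧ ∑ k, ‖a k‖ * ‖b k‖ < c :=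
  exists_of_sInf_projCosts_lt h

lemma exists_of_norm_umTensor_lt {z : UmTensor R S} {c : ℝ} (h : ‖z‖ < c) :
    0 < c ∧ ∃ (n : ℕ) (a : Fin n → R) (b : Fin n → S),
      z = toUm R S (∑ k, a k ⊗ₜ[ℤ] b k) ∧ ∀ k, ‖a k‖ * ‖b k‖ < c :=
  exists_of_sInf_umCosts_lt h

lemma norm_toProj_tmul_le (r : R) (s : S) : ‖toProj R S (r ⊗ₜ[ℤ] s)‖ ≤ ‖r‖ * ‖s‖ := by
  have := norm_toProj_sum_le (ι := Unit) (fun _ => r) (fun _ => s)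
  rwa [Fintype.sum_unique, Fintype.sum_unique] at this

lemma norm_toUm_tmul_le (r : R) (s : S) : ‖toUm R S (r ⊗ₜ[ℤ] s)‖ ≤ ‖r‖ * ‖s‖ := by
  have := norm_toUm_sum_le (ι := Unit) (fun _ => r) (fun _ => s) (c := ‖r‖ * ‖s‖)
    (by positivity) (fun _ => le_rfl)
  rwa [Fintype.sum_unique] at this

lemma norm_umTensor_add_le (x y : UmTensor R S) : ‖x + y‖ ≤ max ‖x‖ ‖y‖ := by
  refine le_of_forall_gt_imp_ge_of_dense fun c hc => ?_
  obtain ⟨hc0, n, a, b, rfl, h1⟩ := exists_of_norm_umTensor_lt ((le_max_left _ _).trans_lt hc)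
  obtain ⟨-, m, a', b', rfl, h2⟩ := exists_of_norm_umTensor_lt ((le_max_right _ _).trans_lt hc)
  have := norm_toUm_sum_le (Sum.elim a a') (Sum.elim b b') hc0.le (by
    rintro (k | k)
    · exact (h1 k).le
    · exact (h2 k).le)
  rwa [Fintype.sum_sum_type, map_add] at this

variable (R S)

/-- The ring homomorphism `r ↦ r ⊗ 1`. -/
noncomputable def projLeft : R →+* BanachTensor R S :=
  (UniformSpace.Completion.coeRingHom (α := ProjTensor R S)).comp
    ((toProj R S).comp Algebra.TensorProduct.includeLeftRingHom)

/-- The ring homomorphism `s ↦ 1 ⊗ s`. -/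
noncomputable def projRight : S →+* BanachTensor R S :=
  (UniformSpace.Completion.coeRingHom (α := ProjTensor R S)).comp
    ((toProj R S).comp (Algebra.TensorProduct.includeRight : S →ₐ[ℤ] R ⊗[ℤ] S).toRingHom)

/-- The ring homomorphism `r ↦ r ⊗ 1`. -/
noncomputable def umLeft : R →+* UmBanachTensor R S :=
  (UniformSpace.Completion.coeRingHom (α := UmTensor R S)).comp
    ((toUm R S).comp Algebra.TensorProduct.includeLeftRingHom)

/-- The ring homomorphism `s ↦ 1 ⊗ s`. -/
noncomputable def umRight : S →+* UmBanachTensor R S :=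
  (UniformSpace.Completion.coeRingHom (α := UmTensor R S)).comp
    ((toUm R S).comp (Algebra.TensorProduct.includeRight : S →ₐ[ℤ] R ⊗[ℤ] S).toRingHom)

variable {R S}

lemma projLeft_apply (r : R) :
    projLeft R S r = (toProj R S (r ⊗ₜ[ℤ] (1 : S)) : BanachTensor R S) := rfl

lemma projRight_apply (s : S) :
    projRight R S s = (toProj R S ((1 : R) ⊗ₜ[ℤ] s) : BanachTensor R S) := rfl

lemma umLeft_apply (r : R) :
    umLeft R S r = (toUm R S (r ⊗ₜ[ℤ] (1 : S)) : UmBanachTensor R S) := rfl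

lemma umRight_apply (s : S) :
    umRight R S s = (toUm R S ((1 : R) ⊗ₜ[ℤ] s) : UmBanachTensor R S) := rfl

lemma norm_projLeft_le [NormOneClass S] (r : R) : ‖projLeft R S r‖ ≤ ‖r‖ := by
  rw [projLeft_apply, UniformSpace.Completion.norm_coe]
  simpa using norm_toProj_tmul_le r (1 : S)

lemma norm_projRight_le [NormOneClass R] (s : S) : ‖projRight R S s‖ ≤ ‖s‖ := by
  rw [projRight_apply, UniformSpace.Completion.norm_coe]
  simpa using norm_toProj_tmul_le (1 : R) s

lemma norm_umLeft_le [NormOneClass S] (r : R) : ‖umLeft R S r‖ ≤ ‖r‖ := by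
  rw [umLeft_apply, UniformSpace.Completion.norm_coe]
  simpa using norm_toUm_tmul_le r (1 : S)

lemma norm_umRight_le [NormOneClass R] (s : S) : ‖umRight R S s‖ ≤ ‖s‖ := by
  rw [umRight_apply, UniformSpace.Completion.norm_coe]
  simpa using norm_toUm_tmul_le (1 : R) s

lemma commute_tmul (r : R) (s : S) : Commute (r ⊗ₜ[ℤ] (1 : S)) ((1 : R) ⊗ₜ[ℤ] s) := by
  simp [Commute, SemiconjBy]

lemma commute_projLeft_projRight (r : R) (s : S) : Commute (projLeft R S r) (projRight R S s) :=
  ((commute_tmul r s).map (toProj R S)).map UniformSpace.Completion.coeRingHom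

lemma commute_umLeft_umRight (r : R) (s : S) : Commute (umLeft R S r) (umRight R S s) :=
  ((commute_tmul r s).map (toUm R S)).map UniformSpace.Completion.coeRingHom

lemma shift_eq (a : R) (s : S) : shift a s = projRight R S s - projLeft R S a :=
  UniformSpace.Completion.coe_sub (α := ProjTensor R S) _ _

lemma umShift_eq (a : R) (s : S) : umShift a s = umRight R S s - umLeft R S a :=
  UniformSpace.Completion.coe_sub (α := UmTensor R S) _ _

lemma nnnorm_umBanachTensor_add_le (x y : UmBanachTensor R S) :
    ‖x + y‖₊ ≤ max ‖x‖₊ ‖y‖₊ := by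
  refine UniformSpace.Completion.induction_on₂ x y ?_ fun x y => ?_
  · exact isClosed_le (by fun_prop) (by fun_prop)
  · rw [← UniformSpace.Completion.coe_add, UniformSpace.Completion.nnnorm_coe,
      UniformSpace.Completion.nnnorm_coe, UniformSpace.Completion.nnnorm_coe]
    exact norm_umTensor_add_le x y

lemma nnnorm_sum_le_of_max {B : Type*} [NormedRing B]
    (hB : ∀ x y : B, ‖x + y‖₊ ≤ max ‖x‖₊ ‖y‖₊) {ι : Type*} (s : Finset ι) (f : ι → B) {c : ℝ≥0}
    (h : ∀ i ∈ s, ‖f i‖₊ ≤ c) : ‖∑ i ∈ s, f i‖₊ ≤ c :=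
  Finset.sum_induction f (fun x => ‖x‖₊ ≤ c)
    (fun x y hx hy => (hB x y).trans (max_le hx hy)) (by simp) h

variable {B : Type*} [NormedRing B] [CompleteSpace B]

omit [CompleteSpace B] in
theorem exists_tensorLift (f : R →+* B) (g : S →+* B) (hfg : ∀ r s, Commute (f r) (g s)) :
    ∃ φ : R ⊗[ℤ] S →+* B, ∀ r s, φ (r ⊗ₜ[ℤ] s) = f r * g s :=
  ⟨(Algebra.TensorProduct.lift f.toIntAlgHom g.toIntAlgHom hfg).toRingHom, fun r s =>
    Algebra.TensorProduct.lift_tmul _ _ _ r s⟩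

/-- The cost of any representation of a tensor bounds the norm of its image, so the algebraic lift
is contractive and extends to the completion. -/
theorem exists_hom_banachTensor (f : R →+* B) (g : S →+* B) (hf : ∀ r, ‖f r‖ ≤ ‖r‖)
    (hg : ∀ s, ‖g s‖ ≤ ‖s‖) (hfg : ∀ r s, Commute (f r) (g s)) :
    ∃ h : BanachTensor R S →+* B, (∀ r, h (projLeft R S r) = f r) ∧
      ∀ s, h (projRight R S s) = g s := by
  obtain ⟨φ₀, hφ₀⟩ := exists_tensorLift f g hfg
  obtain ⟨φ, hφ⟩ : ∃ φ : ProjTensor R S →+* B, ∀ z, φ (toProj R S z) = φ₀ z := ⟨φ₀, fun z => rfl⟩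
  have hb : ∀ z : ProjTensor R S, ‖φ z‖ ≤ 1 * ‖z‖ := by
    intro z
    rw [one_mul]
    refine le_of_forall_gt_imp_ge_of_dense fun c hc => ?_
    obtain ⟨n, a, b, rfl, h⟩ := exists_of_norm_projTensor_lt hc
    simp only [hφ, map_sum, hφ₀]
    exact (norm_sum_le_of_le _ fun k _ => (norm_mul_le _ _).trans
      (mul_le_mul (hf _) (hg _) (norm_nonneg _) (norm_nonneg _))).trans h.le
  have hc : Continuous φ := AddMonoidHomClass.continuous_of_bound φ 1 hb
  refine ⟨UniformSpace.Completion.extensionHom φ hc, fun r => ?_, fun s => ?_⟩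
  · rw [projLeft_apply, UniformSpace.Completion.extensionHom_coe, hφ, hφ₀]
    simp
  · rw [projRight_apply, UniformSpace.Completion.extensionHom_coe, hφ, hφ₀]
    simp

theorem exists_hom_umBanachTensor (hB : ∀ x y : B, ‖x + y‖₊ ≤ max ‖x‖₊ ‖y‖₊) (f : R →+* B)
    (g : S →+* B) (hf : ∀ r, ‖f r‖ ≤ ‖r‖) (hg : ∀ s, ‖g s‖ ≤ ‖s‖)
    (hfg : ∀ r s, Commute (f r) (g s)) :
    ∃ h : UmBanachTensor R S →+* B, (∀ r, h (umLeft R S r) = f r) ∧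
      ∀ s, h (umRight R S s) = g s := by
  obtain ⟨φ₀, hφ₀⟩ := exists_tensorLift f g hfg
  obtain ⟨φ, hφ⟩ : ∃ φ : UmTensor R S →+* B, ∀ z, φ (toUm R S z) = φ₀ z := ⟨φ₀, fun z => rfl⟩
  have hb : ∀ z : UmTensor R S, ‖φ z‖ ≤ 1 * ‖z‖ := by
    intro z
    rw [one_mul]
    refine le_of_forall_gt_imp_ge_of_dense fun c hc => ?_
    obtain ⟨hc0, n, a, b, rfl, h⟩ := exists_of_norm_umTensor_lt hc
    simp only [hφ, map_sum, hφ₀]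
    lift c to ℝ≥0 using hc0.le
    exact nnnorm_sum_le_of_max hB _ _ fun k _ => ((norm_mul_le _ _).trans
      (mul_le_mul (hf _) (hg _) (norm_nonneg _) (norm_nonneg _))).trans (h k).le
  have hc : Continuous φ := AddMonoidHomClass.continuous_of_bound φ 1 hb
  refine ⟨UniformSpace.Completion.extensionHom φ hc, fun r => ?_, fun s => ?_⟩
  · rw [umLeft_apply, UniformSpace.Completion.extensionHom_coe, hφ, hφ₀]
    simp
  · rw [umRight_apply, UniformSpace.Completion.extensionHom_coe, hφ, hφ₀]
    simp

end TensorMaps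

/-! ### The spectra as images of spectral seminorms. -/

section Spectrum

variable {R : Type u} [NormedRing R] [NormOneClass R]

omit [NormOneClass R] in
lemma toAffineLine_eq {op : ℝ≥0 → ℝ≥0 → ℝ≥0} (hop : IsAgg op) {a : R} {N : R[X] → ℝ≥0}
    (h : IsSpectral op a N) {K : Type v} [NormedField K] {s : K}
    (hs : ∀ q : ℤ[X], N (intPoly R q) = ‖aeval s q‖₊) : h.toAffineLine hop = evalSeminorm s :=
  DFunLike.ext (F := MulRingSeminorm ℤ[X]) _ _ fun q => congrArg NNReal.toReal (hs q)

/-- Ring homomorphisms preserve units, so non-invertibility in the Banach ring built from `N` passes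
back to the tensor product. The latter is then non-zero, as everything is a unit in the zero ring.
-/
theorem berSpectrum_eq_range (α : Cardinal.{v}) (hα : Cardinal.aleph0 ≤ α) (a : R) :
    berSpectrum α a = Set.range fun N : {N : R[X] → ℝ≥0 // IsSpectral (· + ·) a N} =>
      N.2.toAffineLine isAgg_add := by
  ext x
  constructor
  · rintro ⟨_, ⟨K, s, rfl, -, hu⟩, rfl⟩
    rw [shift_eq] at hu
    obtain ⟨N, hN, hs⟩ := exists_isSpectral_of_not_isUnit (op := (· + ·)) nnnorm_add_le
      (projLeft R K) (projRight R K) norm_projLeft_le norm_projRight_le commute_projLeft_projRight hu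
    exact ⟨⟨N, hN⟩, toAffineLine_eq _ hN hs⟩
  · rintro ⟨⟨N, hN⟩, rfl⟩
    obtain ⟨B, _, _, K, s, f, g, -, hf, hg, hfg, hu, hs⟩ := hN.exists_scalar isAgg_add α hα
    obtain ⟨h, h1, h2⟩ := exists_hom_banachTensor f g hf hg hfg
    have hns : ¬ IsUnit (shift a s) := fun hus => hu (by
      have := hus.map h
      rwa [shift_eq, map_sub, h1, h2] at this)
    refine ⟨scalarClass K s, ⟨K, s, rfl, ?_, hns⟩, (toAffineLine_eq _ hN hs).symm⟩
    by_contra hn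
    rw [not_nontrivial_iff_subsingleton] at hn
    exact hns (isUnit_of_subsingleton _)

theorem umSpectrum_eq_range (α : Cardinal.{v}) (hα : Cardinal.aleph0 ≤ α) (a : R) :
    umSpectrum α a = Set.range fun N : {N : R[X] → ℝ≥0 // IsSpectral max a N} =>
      N.2.toAffineLine isAgg_max := by
  ext x
  constructor
  · rintro ⟨_, ⟨K, s, rfl, -, hu⟩, rfl⟩
    rw [umShift_eq] at hu
    obtain ⟨N, hN, hs⟩ := exists_isSpectral_of_not_isUnit (op := max)
      nnnorm_umBanachTensor_add_le (umLeft R K) (umRight R K)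
      norm_umLeft_le norm_umRight_le commute_umLeft_umRight hu
    exact ⟨⟨N, hN⟩, toAffineLine_eq _ hN hs⟩
  · rintro ⟨⟨N, hN⟩, rfl⟩
    obtain ⟨B, _, _, K, s, f, g, hB, hf, hg, hfg, hu, hs⟩ := hN.exists_scalar isAgg_max α hα
    obtain ⟨h, h1, h2⟩ := exists_hom_umBanachTensor hB f g hf hg hfg
    have hns : ¬ IsUnit (umShift a s) := fun hus => hu (by
      have := hus.map h
      rwa [umShift_eq, map_sub, h1, h2] at this)
    refine ⟨scalarClass K s, ⟨K, s, rfl, ?_, hns⟩, (toAffineLine_eq _ hN hs).symm⟩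
    by_contra hn
    rw [not_nontrivial_iff_subsingleton] at hn
    exact hns (isUnit_of_subsingleton _)

/-! ### Non-emptiness -/

omit [NormOneClass R] in
lemma exists_evalHom {B : Type*} [Ring B] (f : R →+* B) (x : B) (h : ∀ r, Commute (f r) x) :
    ∃ Φ : R[X] →+* B, (∀ r, Φ (C r) = f r) ∧ Φ X = x :=
  ⟨eval₂RingHom' f x h, fun r => by simp, by simp⟩

omit [NormOneClass R] in
/-- The seminorm on `R[X]` induced by a seminorm on `R ⊗ ℤ[a]` witnesses that the spectrum is not
empty. -/
theorem exists_isSpectral_of_tensor {op : ℝ≥0 → ℝ≥0 → ℝ≥0} (hop : IsAgg op) (a : R)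
    {N : R ⊗[ℤ] (Algebra.adjoin ℤ {a}) → ℝ≥0} (hN : IsSN op N)
    (hle : ∀ r, N (r ⊗ₜ 1) ≤ ‖r‖₊)
    (hone : ∀ ev : R ⊗[ℤ] (Algebra.adjoin ℤ {a}) →+ R, (∀ r s, ev (r ⊗ₜ s) = s * r) →
      ∀ z, ev z = 1 → 1 ≤ N z) :
    ∃ N, IsSpectral op a N := by
  let S := Algebra.adjoin ℤ {a}
  let aS : S := ⟨a, Algebra.self_mem_adjoin_singleton ℤ a⟩
  have hcS : ∀ s : S, (s : R) * a = a * s := fun s =>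
    Algebra.adjoin_induction (p := fun x _ => x * a = a * x) (by rintro _ rfl; rfl)
      (fun n => (Algebra.commutes n a))
      (fun x y _ _ hx hy => by rw [add_mul, mul_add, hx, hy])
      (fun x y _ _ hx hy => by rw [mul_assoc, hy, ← mul_assoc, hx, mul_assoc]) s.2
  obtain ⟨Φ, hC, hX⟩ := exists_evalHom
    (Algebra.TensorProduct.includeLeftRingHom : R →+* R ⊗[ℤ] S) ((1 : R) ⊗ₜ[ℤ] aS)
    fun r => commute_tmul r aS
  replace hC : ∀ r, Φ (C r) = r ⊗ₜ 1 := hC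
  obtain ⟨ev, hev⟩ : ∃ ev : R ⊗[ℤ] S →+ R, ∀ r s, ev (r ⊗ₜ s) = s * r :=
    ⟨(TensorProduct.lift ((LinearMap.mul ℤ R).flip.compl₂ S.val.toLinearMap)).toAddMonoidHom,
      fun r s => rfl⟩
  -- The factor from `ℤ[a]` stands on the left in `ev`: `r ⊗ s` contributes `a s r - s a r`, which
  -- vanishes since `s` commutes with `a`. Hence `ev` sends `1 - u e` to `1` for every `e`.
  have hkill : ∀ z, ev ((1 ⊗ₜ aS - a ⊗ₜ 1) * z) = 0 := by
    intro z
    induction z using TensorProduct.induction_on with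
    | zero => simp
    | add x y hx hy => rw [mul_add, map_add, hx, hy, add_zero]
    | tmul r s =>
      rw [sub_mul, Algebra.TensorProduct.tmul_mul_tmul, Algebra.TensorProduct.tmul_mul_tmul,
        map_sub, hev, hev, one_mul, one_mul, Subalgebra.coe_mul, ← mul_assoc, hcS, sub_self]
  have h₀ : IsSN op fun p => N (Φ p) :=
    { zero := by rw [map_zero, hN.zero]
      one := by rw [map_one]; exact hN.one
      neg := fun x => by rw [map_neg, hN.neg]
      add := fun x y => by rw [map_add]; exact hN.add _ _
      mul := fun x y => by rw [map_mul]; exact hN.mul _ _ }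
  have hu : ¬ Inv (fun p => N (Φ p)) (X - C a) := by
    rintro ⟨e, h1, -⟩
    refine absurd h1 (not_lt.2 (hone ev hev _ ?_))
    rw [map_sub, map_mul, map_sub Φ X, hX, hC, map_sub, hkill, map_one, sub_zero,
      Algebra.TensorProduct.one_def, hev]
    simp
  obtain ⟨N', hN', hle', h1, hmul, hinv⟩ := exists_minimal_seminorm hop h₀ hu
  exact ⟨N', hN', h1, fun r => (hle' _).trans ((congrArg N (hC r)).trans_le (hle r)),
    fun q b => hmul _ (intPoly_central q) b, fun q c => hinv _ (intPoly_central q) c⟩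

end Spectrum

section Nonempty

variable {R : Type u} [NormedRing R] [NormOneClass R]

/-- Evaluation `r ⊗ s ↦ s r` is contractive for the projective seminorm, so anything evaluating to
`1` has seminorm at least `‖1‖ = 1`. -/
theorem exists_isSpectral_add (a : R) : ∃ N, IsSpectral (· + ·) a N := by
  let S := Algebra.adjoin ℤ {a}
  let _ : NormedRing S := inferInstanceAs (NormedRing S.toSubring)
  have hS : ∀ s : S, ‖s‖ = ‖(s : R)‖ := fun s => rfl
  have : NormOneClass S := ⟨(norm_one : ‖(1 : R)‖ = 1)⟩
  refine exists_isSpectral_of_tensor isAgg_add a (N := fun z => ‖toProj R S z‖₊)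
    ⟨by simp, ?_, fun x => by rw [map_neg, nnnorm_neg], fun x y => ?_, fun x y => ?_⟩
    (fun r => ?_) (fun ev hev z hz => ?_)
  · have : ‖toProj R S 1‖ ≤ 1 := by simpa [Algebra.TensorProduct.one_def] using norm_toProj_tmul_le (1 : R) (1 : S)
    exact this
  · rw [map_add]; exact nnnorm_add_le _ _
  · rw [map_mul]; exact nnnorm_mul_le _ _
  · have : ‖toProj R S (r ⊗ₜ 1)‖ ≤ ‖r‖ := by simpa using norm_toProj_tmul_le r (1 : S)
    exact this
  · by_contra! hlt
    obtain ⟨n, r, s, hrs, h⟩ := exists_of_norm_projTensor_lt (c := 1) hlt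
    replace hrs : z = ∑ k, r k ⊗ₜ[ℤ] s k := hrs
    rw [hrs, map_sum] at hz
    have : ‖(1 : R)‖ < 1 := by
      rw [← hz]
      refine (norm_sum_le_of_le _ fun k _ => ?_).trans_lt h
      rw [hev, mul_comm ‖r k‖]
      exact norm_mul_le _ _
    simp at this

/-- The ring `R` need not be ultrametric, so `ψ` has to detect the unit. If `1 = ∑ s_k r_k` with all
costs at most `c < 1`, then `ψ b = ∑ ψ (b s_k r_k)`; iterating gives `‖ψ b‖ ≤ c ^ m * ‖b‖` for all
`m`, so `ψ = 0`. -/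
theorem exists_isSpectral_max (a : R) {L : Type*} [NormedField L] [IsUltrametricDist L]
    (ψ : R →+ L) (hψ0 : ψ ≠ 0) (hψ : ∀ x, ‖ψ x‖ ≤ ‖x‖) : ∃ N, IsSpectral max a N := by
  let S := Algebra.adjoin ℤ {a}
  let _ : NormedRing S := inferInstanceAs (NormedRing S.toSubring)
  have hS : ∀ s : S, ‖s‖ = ‖(s : R)‖ := fun s => rfl
  have : NormOneClass S := ⟨(norm_one : ‖(1 : R)‖ = 1)⟩
  refine exists_isSpectral_of_tensor isAgg_max a (N := fun z => ‖toUm R S z‖₊)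
    ⟨by simp, ?_, fun x => by rw [map_neg, nnnorm_neg], fun x y => ?_, fun x y => ?_⟩
    (fun r => ?_) (fun ev hev z hz => ?_)
  · have : ‖toUm R S 1‖ ≤ 1 := by simpa [Algebra.TensorProduct.one_def] using norm_toUm_tmul_le (1 : R) (1 : S)
    exact this
  · rw [map_add]; exact norm_umTensor_add_le _ _
  · rw [map_mul]; exact nnnorm_mul_le _ _
  · have : ‖toUm R S (r ⊗ₜ 1)‖ ≤ ‖r‖ := by simpa using norm_toUm_tmul_le r (1 : S)
    exact this
  · by_contra! hlt
    obtain ⟨c, hc, hc1⟩ := exists_between (show ‖toUm R S z‖ < 1 from hlt)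
    obtain ⟨hc0, n, r, s, hrs, h⟩ := exists_of_norm_umTensor_lt hc
    replace hrs : z = ∑ k, r k ⊗ₜ[ℤ] s k := hrs
    rw [hrs, map_sum] at hz
    have key : ∀ (m : ℕ) (b : R), ‖ψ b‖ ≤ c ^ m * ‖b‖ := by
      intro m
      induction m with
      | zero => simpa using hψ
      | succ m ih =>
        intro b
        have e : ψ b = ∑ k, ψ (b * (s k * r k)) := by
          rw [← map_sum, ← Finset.mul_sum]
          simp only [hev] at hz
          rw [hz, mul_one]
        rw [e]
        refine IsUltrametricDist.norm_sum_le_of_forall_le_of_nonneg (by positivity) fun k _ => ?_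
        calc ‖ψ (b * (s k * r k))‖ ≤ c ^ m * ‖b * (s k * r k)‖ := ih _
          _ ≤ c ^ m * (‖b‖ * c) := by
            gcongr
            refine (norm_mul_le _ _).trans ?_
            gcongr
            refine (norm_mul_le _ _).trans ?_
            rw [mul_comm]
            exact (h k).le
          _ = c ^ (m + 1) * ‖b‖ := by ring
    refine hψ0 (AddMonoidHom.ext fun b => ?_)
    have ht : Tendsto (fun m : ℕ => c ^ m * ‖b‖) atTop (𝓝 0) := by
      simpa using (tendsto_pow_atTop_nhds_zero_of_lt_one hc0.le hc1).mul_const ‖b‖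
    exact norm_le_zero_iff.1 (ge_of_tendsto' ht fun m => key m b)

end Nonempty

/-! ### Reduction to minimal fields. -/

section Ultrametric

variable {R : Type u} [NormedRing R] [NormOneClass R]

/-- In the tensor product `1` is a sum of `n` copies of `1 / n`, so its norm `1` is at most `‖n⁻¹‖`;
this bounds every integer by `1` in norm. -/
lemma isUltrametricDist_of_nontrivial {K : Type v} [NormedField K]
    [Nontrivial (UmBanachTensor R K)] : IsUltrametricDist K := by
  refine IsUltrametricDist.isUltrametricDist_of_forall_norm_natCast_le_one fun n => ?_
  by_contra! hn
  have hn0 : (n : K) ≠ 0 := norm_pos_iff.1 (zero_lt_one.trans hn)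
  have h1 : (1 : UmBanachTensor R K) = ∑ _k ∈ Finset.range n, umRight R K (n : K)⁻¹ := by
    rw [Finset.sum_const, Finset.card_range, nsmul_eq_mul, ← map_natCast (umRight R K), ← map_mul,
      mul_inv_cancel₀ hn0, map_one]
  have h2 : ‖(1 : UmBanachTensor R K)‖₊ ≤ ‖(n : K)⁻¹‖₊ := by
    rw [h1]
    exact nnnorm_sum_le_of_max nnnorm_umBanachTensor_add_le _ _ fun k _ => norm_umRight_le _
  have h3 : ‖(1 : UmBanachTensor R K)‖ ≤ ‖(n : K)⁻¹‖ := h2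
  rw [norm_one_of_nontrivial (umRight R K) norm_umRight_le, norm_inv] at h3
  exact absurd h3 (not_le.2 (inv_lt_one_of_one_lt₀ hn))

/-- The closure of the prime field lies in every complete subfield. Its tensor product is non-zero
because it maps unitally to that of `K`. -/
theorem exists_minimal_subfield {α : Cardinal.{v}} (K : ValField α)
    [Nontrivial (UmBanachTensor R K)] :
    ∃ K₀ : ValField α, K₀.IsUm ∧ K₀.IsMinimal ∧ Nontrivial (UmBanachTensor R K₀) := by
  let P : Subfield K := (⊥ : Subfield K).topologicalClosure
  have hP : IsClosed (P : Set K) := Subfield.isClosed_topologicalClosure _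
  have : CompleteSpace P := hP.completeSpace_coe
  let K₀ : ValField α := ⟨P, (Cardinal.mk_subtype_le _).trans K.card_le⟩
  let i : K₀ →+* K := P.subtype
  have hi : ∀ x, ‖i x‖ = ‖x‖ := fun x => rfl
  obtain ⟨h, -, -⟩ := exists_hom_umBanachTensor (R := R) (S := K₀) (B := UmBanachTensor R K)
    nnnorm_umBanachTensor_add_le (umLeft R K) ((umRight R K).comp i) norm_umLeft_le
    (fun k => norm_umRight_le (i k)) (fun r k => commute_umLeft_umRight r (i k))
  have hnt : Nontrivial (UmBanachTensor R K₀) := h.domain_nontrivial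
  refine ⟨K₀, isUltrametricDist_of_nontrivial (R := R), fun F hF => ?_, hnt⟩
  have hiso : Isometry i := AddMonoidHomClass.isometry_of_norm i hi
  have hc : IsClosed ((F.map i : Subfield K) : Set K) := by
    rw [Subfield.coe_map]
    exact (hiso.isUniformInducing.isComplete_iff.2 hF).isClosed
  have hle : P ≤ F.map i := Subfield.topologicalClosure_minimal _ bot_le hc
  rw [eq_top_iff]
  intro x _
  obtain ⟨y, hy, hyx⟩ := hle (show (i x : K) ∈ P from x.2)
  rwa [i.injective hyx] at hy

end Ultrametric

/-! ### Spherical completeness of minimal fields. -/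

section Spherical

/-- A normed field is spherically complete if every family of pairwise intersecting closed balls,
indexed here by a set of pairs (centre, radius), has a common point. -/
def IsSphericallyComplete (K : Type v) [NormedField K] : Prop :=
  ∀ S : Set (K × ℝ), (∀ x ∈ S, ∀ y ∈ S, ‖x.1 - y.1‖ ≤ max x.2 y.2) →
    ∃ c, ∀ x ∈ S, ‖c - x.1‖ ≤ x.2

variable {K : Type v} [NormedField K]

/-- Distinct points have distance `1`: a ball of radius below `1` is a single point, whose centre
serves, and all other balls are the whole field. -/
theorem isSphericallyComplete_of_norm_eq_one (h : ∀ k : K, k ≠ 0 → ‖k‖ = 1) :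
    IsSphericallyComplete K := by
  intro S hS
  have hr : ∀ x ∈ S, 0 ≤ x.2 := fun x hx => by simpa using hS x hx x hx
  have hle : ∀ k : K, ‖k‖ ≤ 1 := fun k => by
    rcases eq_or_ne k 0 with rfl | hk
    · simp
    · exact (h k hk).le
  by_cases hx : ∃ x ∈ S, x.2 < 1
  · obtain ⟨x, hx, hx1⟩ := hx
    refine ⟨x.1, fun y hy => ?_⟩
    rcases eq_or_ne (x.1 - y.1) 0 with h0 | h0
    · rw [h0, norm_zero]
      exact hr y hy
    · have := hS x hx y hy
      rw [h _ h0] at this ⊢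
      exact (le_max_iff.1 this).resolve_left (not_le.2 hx1)
  · push Not at hx
    exact ⟨0, fun x hxS => (hle _).trans (hx x hxS)⟩

theorem isSphericallyComplete_of_properSpace [IsUltrametricDist K] [ProperSpace K] :
    IsSphericallyComplete K := by
  intro S hS
  rcases S.eq_empty_or_nonempty with rfl | hne
  · exact ⟨0, by simp⟩
  have : Nonempty S := hne.to_subtype
  have hr : ∀ x ∈ S, 0 ≤ x.2 := fun x hx => by simpa using hS x hx x hx
  have key : ∀ x ∈ S, ∀ y ∈ S, x.2 ≤ y.2 →
      Metric.closedBall x.1 x.2 ⊆ Metric.closedBall y.1 y.2 := by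
    intro x hx y hy hxy z hz
    have h1 := hS x hx y hy
    rw [max_eq_right hxy, ← dist_eq_norm] at h1
    exact (dist_triangle_max z x.1 y.1).trans (max_le (hz.trans hxy) h1)
  have hdir : Directed (· ⊇ ·) fun x : S => Metric.closedBall x.1.1 x.1.2 := by
    intro x y
    rcases le_total x.1.2 y.1.2 with h | h
    · exact ⟨x, subset_rfl, key x x.2 y y.2 h⟩
    · exact ⟨y, key y y.2 x x.2 h, subset_rfl⟩
  obtain ⟨c, hc⟩ := IsCompact.nonempty_iInter_of_directed_nonempty_isCompact_isClosed _ hdir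
    (fun x => ⟨_, Metric.mem_closedBall_self (hr x x.2)⟩) (fun x => isCompact_closedBall _ _)
    (fun x => Metric.isClosed_closedBall)
  refine ⟨c, fun x hx => ?_⟩
  have := Set.mem_iInter.1 hc ⟨x, hx⟩
  rwa [Metric.mem_closedBall, dist_eq_norm] at this

/-- Expanding in powers of `p` with digits in `J` yields finite nets of the unit ball at every scale
`‖p‖ ^ n`, so the unit ball is compact. -/
theorem properSpace_of_residues [CompleteSpace K] {p : K} (hp0 : p ≠ 0) (hp : ‖p‖ < 1)
    (J : Finset K) (hJ : ∀ x : K, ‖x‖ ≤ 1 → ∃ j ∈ J, ‖x - j‖ ≤ ‖p‖) : ProperSpace K := by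
  classical
  have hp' : 0 < ‖p‖ := norm_pos_iff.2 hp0
  have cover : ∀ n : ℕ, ∃ t : Finset K, ∀ x : K, ‖x‖ ≤ 1 → ∃ y ∈ t, ‖x - y‖ ≤ ‖p‖ ^ n := by
    intro n
    induction n with
    | zero => exact ⟨{0}, fun x hx => ⟨0, by simp, by simpa using hx⟩⟩
    | succ n ih =>
      obtain ⟨t, ht⟩ := ih
      refine ⟨(J ×ˢ t).image fun z => z.1 + p * z.2, fun x hx => ?_⟩
      obtain ⟨j, hj, hxj⟩ := hJ x hx
      obtain ⟨y, hy, hxy⟩ := ht (p⁻¹ * (x - j)) (by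
        rw [norm_mul, norm_inv]
        exact inv_mul_le_one_of_le₀ hxj hp'.le)
      refine ⟨j + p * y, Finset.mem_image.2 ⟨(j, y), Finset.mem_product.2 ⟨hj, hy⟩, rfl⟩, ?_⟩
      have : x - (j + p * y) = p * (p⁻¹ * (x - j) - y) := by field_simp; ring
      rw [this, norm_mul, pow_succ']
      exact mul_le_mul_of_nonneg_left hxy hp'.le
  have htb : TotallyBounded (Metric.closedBall (0 : K) 1) := by
    refine Metric.totallyBounded_iff.2 fun ε hε => ?_
    obtain ⟨n, hn⟩ := exists_pow_lt_of_lt_one hε hp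
    obtain ⟨t, ht⟩ := cover n
    refine ⟨t, t.finite_toSet, fun x hx => ?_⟩
    obtain ⟨y, hy, hxy⟩ := ht x (by simpa using hx)
    exact Set.mem_biUnion hy (by rw [Metric.mem_ball, dist_eq_norm]; exact hxy.trans_lt hn)
  let _ : NontriviallyNormedField K :=
    { (inferInstance : NormedField K) with
      non_trivial := ⟨p⁻¹, by rw [norm_inv]; exact (one_lt_inv₀ hp').2 hp⟩ }
  have hcpt : IsCompact (Metric.closedBall (0 : K) 1) :=
    isCompact_iff_totallyBounded_isComplete.2 ⟨htb, Metric.isClosed_closedBall.isComplete⟩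
  have := hcpt.locallyCompactSpace_of_mem_nhds_of_addGroup
    (Metric.closedBall_mem_nhds (0 : K) one_pos)
  exact ProperSpace.of_nontriviallyNormedField_of_weaklyLocallyCompactSpace K

theorem norm_intCast_eq_one [IsUltrametricDist K] {p : ℤ} (hp : ‖(p : K)‖ < 1) {m : ℤ}
    (h : IsCoprime m p) : ‖(m : K)‖ = 1 := by
  refine le_antisymm (IsUltrametricDist.norm_intCast_le_one K m) ?_
  obtain ⟨u, v, huv⟩ := h
  have h1 : (u : K) * m + v * p = 1 := by exact_mod_cast congrArg (Int.cast : ℤ → K) huv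
  have h2 : (1 : ℝ) ≤ max ‖(u : K) * m‖ ‖(v : K) * p‖ := by
    rw [← norm_one (α := K), ← h1]
    exact IsUltrametricDist.norm_add_le_max _ _
  have hu := IsUltrametricDist.norm_intCast_le_one K u
  have hv := IsUltrametricDist.norm_intCast_le_one K v
  rcases le_max_iff.1 h2 with h | h
  · rw [norm_mul] at h
    nlinarith [norm_nonneg (m : K)]
  · rw [norm_mul] at h
    nlinarith [norm_nonneg (p : K)]

/-- Once powers of `p` are cancelled, the fraction is `d / b'` with `b'` prime to `p`, and a Bézout
inverse `u` of `b'` gives the residue `u * d` modulo `p`. -/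
theorem exists_intCast_near [IsUltrametricDist K] {p : ℕ} (hpp : p.Prime) (hp0 : (p : K) ≠ 0)
    (hp : ‖(p : K)‖ < 1) (a b : ℤ) (hb : (b : K) ≠ 0) (hab : ‖(a / b : K)‖ ≤ 1) :
    ∃ j ∈ Finset.Ico (0 : ℤ) p, ‖(a / b : K) - j‖ ≤ ‖(p : K)‖ := by
  have hpZ : Prime (p : ℤ) := Nat.prime_iff_prime_int.1 hpp
  have hp' : ‖((p : ℤ) : K)‖ < 1 := by simpa using hp
  have hpos : 0 < ‖(p : K)‖ := norm_pos_iff.2 hp0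
  have cop : ∀ m : ℤ, ¬ (p : ℤ) ∣ m → IsCoprime m p := fun m hm =>
    (hpZ.coprime_iff_not_dvd.2 hm).symm
  have hb0 : b ≠ 0 := by rintro rfl; simp at hb
  obtain ⟨k, b', hb', rfl⟩ := (Int.finiteMultiplicity_iff.2 ⟨by simpa using hpp.ne_one, hb0⟩
    : FiniteMultiplicity (p : ℤ) b).exists_eq_pow_mul_and_not_dvd |>.elim
      fun c hc => (⟨_, c, hc.2, hc.1⟩ : ∃ k b', ¬ (p : ℤ) ∣ b' ∧ b = (p : ℤ) ^ k * b')
  have hnb := norm_intCast_eq_one hp' (cop b' hb')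
  obtain ⟨d, hd⟩ : ∃ d : ℤ, (a / ((p ^ k * b' : ℤ) : K)) = d / b' := by
    rcases eq_or_ne a 0 with rfl | ha0
    · exact ⟨0, by simp⟩
    obtain ⟨l, a', ha', rfl⟩ := (Int.finiteMultiplicity_iff.2 ⟨by simpa using hpp.ne_one, ha0⟩
      : FiniteMultiplicity (p : ℤ) a).exists_eq_pow_mul_and_not_dvd |>.elim
        fun c hc => (⟨_, c, hc.2, hc.1⟩ : ∃ k b', ¬ (p : ℤ) ∣ b' ∧ a = (p : ℤ) ^ k * b')
    have hna := norm_intCast_eq_one hp' (cop a' ha')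
    have hlk : k ≤ l := by
      push_cast at hab
      rw [norm_div, norm_mul, norm_mul, norm_pow, norm_pow, hna, hnb, mul_one, mul_one,
        div_le_one (by positivity)] at hab
      exact (pow_le_pow_iff_right_of_lt_one₀ hpos hp).1 hab
    refine ⟨p ^ (l - k) * a', ?_⟩
    obtain ⟨r, rfl⟩ := Nat.exists_eq_add_of_le hlk
    push_cast at hb ⊢
    rw [Nat.add_sub_cancel_left, pow_add, mul_assoc, mul_div_mul_left _ _ (pow_ne_zero _ hp0)]
  rw [hd]
  have hb'0 : (b' : K) ≠ 0 := norm_ne_zero_iff.1 (by rw [hnb]; exact one_ne_zero)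
  obtain ⟨u, v, huv⟩ := cop b' hb'
  refine ⟨(u * d) % p, Finset.mem_Ico.2 ⟨Int.emod_nonneg _ hpZ.ne_zero,
    Int.emod_lt_of_pos _ (by exact_mod_cast hpp.pos)⟩, ?_⟩
  obtain ⟨q, hq⟩ : ∃ q : ℤ, d - b' * ((u * d) % p) = p * q := by
    refine ⟨v * d + b' * ((u * d) / p), ?_⟩
    have := Int.emod_add_mul_ediv (u * d) p
    linear_combination (-d) * huv - b' * this
  have hq' : (d / b' : K) - ((u * d) % p : ℤ) = p * q / b' := by
    rw [eq_div_iff hb'0, sub_mul, div_mul_cancel₀ _ hb'0, mul_comm _ (b' : K)]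
    exact_mod_cast congrArg (Int.cast : ℤ → K) hq
  rw [hq', norm_div, norm_mul, hnb, div_one]
  exact mul_le_of_le_one_right hpos.le (IsUltrametricDist.norm_intCast_le_one K q)

theorem mem_bot_subfield {x : K} (hx : x ∈ (⊥ : Subfield K)) :
    ∃ a b : ℤ, (b : K) ≠ 0 ∧ x = a / b := by
  rw [← Subfield.closure_empty, Subfield.mem_closure_iff] at hx
  obtain ⟨y, hy, z, hz, rfl⟩ := hx
  rw [Subring.closure_empty] at hy hz
  obtain ⟨a, rfl⟩ := Subring.mem_bot.1 hy
  obtain ⟨b, rfl⟩ := Subring.mem_bot.1 hz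
  rcases eq_or_ne (b : K) 0 with hb | hb
  · exact ⟨0, 1, by simp, by simp [hb]⟩
  · exact ⟨a, b, hb, rfl⟩

theorem exists_prime_norm_lt_one [IsUltrametricDist K] {n : ℕ} (hn0 : (n : K) ≠ 0)
    (hn : ‖(n : K)‖ < 1) : ∃ p : ℕ, p.Prime ∧ (p : K) ≠ 0 ∧ ‖(p : K)‖ < 1 := by
  induction n using Nat.recOnMul with
  | zero => simp at hn0
  | one => simp at hn
  | prime p hp => exact ⟨p, hp, hn0, hn⟩
  | mul a b iha ihb =>
    push_cast at hn0 hn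
    by_cases ha : ‖(a : K)‖ < 1
    · exact iha (left_ne_zero_of_mul hn0) ha
    · refine ihb (right_ne_zero_of_mul hn0) ?_
      rw [norm_mul] at hn
      nlinarith [norm_nonneg (b : K)]

/-- Either some integer has norm strictly between `0` and `1`, so that a prime does and the field is
proper by its finitely many residues, or all non-zero integers have norm `1` and density makes the
absolute value trivial. -/
theorem isSphericallyComplete_of_dense [IsUltrametricDist K] [CompleteSpace K]
    (hd : Dense ((⊥ : Subfield K) : Set K)) : IsSphericallyComplete K := by
  classical
  have approx : ∀ (x : K) {ε : ℝ}, 0 < ε →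
      ∃ a b : ℤ, (b : K) ≠ 0 ∧ ‖x - a / b‖ < ε := fun x ε hε => by
    obtain ⟨y, hy, hxy⟩ := Metric.dense_iff.1 hd x ε hε
    obtain ⟨a, b, hb, rfl⟩ := mem_bot_subfield hxy
    exact ⟨a, b, hb, by rwa [Metric.mem_ball, dist_comm, dist_eq_norm] at hy⟩
  by_cases h : ∃ n : ℕ, (n : K) ≠ 0 ∧ ‖(n : K)‖ < 1
  · obtain ⟨n, hn0, hn⟩ := h
    obtain ⟨p, hpp, hp0, hp⟩ := exists_prime_norm_lt_one hn0 hn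
    have := properSpace_of_residues hp0 hp ((Finset.Ico (0 : ℤ) p).image Int.cast) fun x hx => by
      obtain ⟨a, b, hb, hab⟩ := approx x (norm_pos_iff.2 hp0)
      have hab1 : ‖(a / b : K)‖ ≤ 1 := by
        have := IsUltrametricDist.norm_add_le_max x (a / b - x : K)
        rw [add_sub_cancel, norm_sub_rev] at this
        exact this.trans (max_le hx (hab.le.trans hp.le))
      obtain ⟨j, hj, hjn⟩ := exists_intCast_near hpp hp0 hp a b hb hab1
      refine ⟨j, Finset.mem_image_of_mem _ hj, ?_⟩
      rw [← sub_add_sub_cancel x (a / b : K)]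
      exact (IsUltrametricDist.norm_add_le_max _ _).trans (max_le hab.le hjn)
    exact isSphericallyComplete_of_properSpace
  · push Not at h
    have hint : ∀ m : ℤ, (m : K) ≠ 0 → ‖(m : K)‖ = 1 := fun m hm => by
      refine le_antisymm (IsUltrametricDist.norm_intCast_le_one K m) ?_
      obtain ⟨n, rfl | rfl⟩ := m.eq_nat_or_neg
      · simpa using h n (by simpa using hm)
      · simpa using h n (by simpa using hm)
    refine isSphericallyComplete_of_norm_eq_one fun k hk => ?_
    obtain ⟨a, b, hb, hab⟩ := approx k (norm_pos_iff.2 hk)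
    have hk' : ‖(a / b : K)‖ = ‖k‖ := by
      rw [norm_sub_rev] at hab
      refine le_antisymm ?_ (le_of_not_gt fun hlt => ?_)
      · have := IsUltrametricDist.norm_add_le_max k (a / b - k : K)
        rwa [add_sub_cancel, max_eq_left hab.le] at this
      · have := IsUltrametricDist.norm_add_le_max (a / b : K) (k - a / b : K)
        rw [add_sub_cancel, norm_sub_rev] at this
        exact absurd this (not_le.2 (max_lt hlt hab))
    have ha : (a : K) ≠ 0 := by
      rintro ha
      rw [ha, zero_div, norm_zero] at hk'
      exact hk (norm_eq_zero.1 hk'.symm)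
    rw [← hk', norm_div, hint a ha, hint b hb, div_one]

theorem ValField.IsMinimal.isSphericallyComplete {α : Cardinal.{v}} {K : ValField α}
    (hu : K.IsUm) (hm : K.IsMinimal) : IsSphericallyComplete K := by
  have : IsUltrametricDist K := hu
  refine isSphericallyComplete_of_dense ?_
  have h := hm (⊥ : Subfield K).topologicalClosure
    (Subfield.isClosed_topologicalClosure _).isComplete
  exact dense_iff_closure_eq.2 (congrArg SetLike.coe h)

end Spherical

/-! ### Ingleton's theorem and contractive maps. -/

section Ingleton

variable {K : Type v} [NormedField K] {V : Type w} [NormedAddCommGroup V] [Module K V]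

/-- Extension of a contractive linear map by one dimension. -/
theorem exists_lt_of_domain_ne_top (hK : IsSphericallyComplete K)
    (hsmul : ∀ (k : K) (v : V), ‖k • v‖ = ‖k‖ * ‖v‖)
    (hadd : ∀ x y : V, ‖x + y‖ ≤ max ‖x‖ ‖y‖) (f : V →ₗ.[K] K)
    (hf : ∀ x : f.domain, ‖f x‖ ≤ ‖(x : V)‖) (hdom : f.domain ≠ ⊤) :
    ∃ g, f < g ∧ ∀ x : g.domain, ‖g x‖ ≤ ‖(x : V)‖ := by
  obtain ⟨y, -, hy⟩ : ∃ y ∈ ⊤, y ∉ f.domain := SetLike.exists_of_lt (lt_top_iff_ne_top.2 hdom)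
  -- The value `c` at `y` must satisfy `‖c - f m‖ ≤ ‖m - y‖` for every `m` in the domain.
  -- Contractivity of `f` and the ultrametric inequality give the pairwise condition on these balls.
  obtain ⟨c, hc⟩ := hK (Set.range fun m : f.domain => (f m, ‖(m : V) - y‖)) (by
    rintro _ ⟨m, rfl⟩ _ ⟨m', rfl⟩
    change ‖f m - f m'‖ ≤ max ‖(m : V) - y‖ ‖(m' : V) - y‖
    rw [← LinearPMap.map_sub, ← norm_neg ((m' : V) - y)]
    refine (hf _).trans ?_
    have := hadd ((m : V) - y) (-((m' : V) - y))
    rwa [← sub_eq_add_neg, sub_sub_sub_cancel_right] at this)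
  have hc' : ∀ m : f.domain, ‖c - f m‖ ≤ ‖(m : V) - y‖ := fun m => hc _ ⟨m, rfl⟩
  refine ⟨f.supSpanSingleton y c hy, ?_, ?_⟩
  · refine lt_iff_le_not_ge.2 ⟨f.left_le_sup _ _, fun H => ?_⟩
    replace H := LinearPMap.domain_mono.monotone H
    rw [LinearPMap.domain_supSpanSingleton, sup_le_iff, Submodule.span_le,
      Set.singleton_subset_iff] at H
    exact hy H.2
  · rintro ⟨z, hz⟩
    rcases Submodule.mem_sup.1 hz with ⟨x, hx, y', hy', rfl⟩
    rcases Submodule.mem_span_singleton.1 hy' with ⟨r, rfl⟩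
    rw [LinearPMap.supSpanSingleton_apply_mk _ _ _ _ _ hx]
    rcases eq_or_ne r 0 with rfl | hr
    · simpa using hf ⟨x, hx⟩
    -- Scaling by `-r` reduces the bound at `x + r y` to the defining inequality of `c` at `m = -r⁻¹
    -- x`.
    · have h1 : f ⟨x, hx⟩ + r • c = r • (c - f (-(r⁻¹ • ⟨x, hx⟩))) := by
        rw [LinearPMap.map_neg, LinearPMap.map_smul]
        rw [smul_eq_mul, smul_eq_mul, smul_eq_mul, sub_neg_eq_add, mul_add,
          mul_inv_cancel_left₀ hr, add_comm]
      have h2 : x + r • y = (-r) • (((-(r⁻¹ • ⟨x, hx⟩) : f.domain) : V) - y) := by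
        simp [smul_sub, smul_smul, hr]
      change ‖f ⟨x, hx⟩ + r • c‖ ≤ ‖x + r • y‖
      rw [h1, h2, hsmul, norm_smul, norm_neg]
      exact mul_le_mul_of_nonneg_left (hc' _) (norm_nonneg r)

/-- Ingleton's theorem, for one norm-one vector. -/
theorem exists_contractive_functional (hK : IsSphericallyComplete K)
    (hsmul : ∀ (k : K) (v : V), ‖k • v‖ = ‖k‖ * ‖v‖)
    (hadd : ∀ x y : V, ‖x + y‖ ≤ max ‖x‖ ‖y‖) (v₀ : V) (hv₀ : ‖v₀‖ = 1) :
    ∃ φ : V →ₗ[K] K, φ v₀ = 1 ∧ ∀ v, ‖φ v‖ ≤ ‖v‖ := by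
  have hv : v₀ ≠ 0 := by rintro rfl; simp at hv₀
  set S := {f : V →ₗ.[K] K | ∀ x : f.domain, ‖f x‖ ≤ ‖(x : V)‖}
  have hSc : ∀ c, c ⊆ S → IsChain (· ≤ ·) c → ∀ y ∈ c, ∃ ub ∈ S, ∀ z ∈ c, z ≤ ub := by
    intro c hcs c_chain y hy
    have hcd : DirectedOn (· ≤ ·) c := c_chain.directedOn
    refine ⟨LinearPMap.sSup c hcd, ?_, fun _ ↦ LinearPMap.le_sSup hcd⟩
    rintro ⟨x, hx⟩
    have hdir : DirectedOn (· ≤ ·) (LinearPMap.domain '' c) :=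
      directedOn_image.2 (hcd.mono LinearPMap.domain_mono.monotone)
    rcases (Submodule.mem_sSup_of_directed (Set.Nonempty.image _ ⟨y, hy⟩) hdir).1 hx with
      ⟨_, ⟨f, hfc, rfl⟩, hfx⟩
    have h : f ⟨x, hfx⟩ = LinearPMap.sSup c hcd ⟨x, hx⟩ := (LinearPMap.le_sSup hcd hfc).2 rfl
    rw [← h]
    exact hcs hfc ⟨x, hfx⟩
  have hp : LinearPMap.mkSpanSingleton v₀ (1 : K) hv ∈ S := by
    rintro ⟨x, hx⟩
    obtain ⟨r, rfl⟩ := Submodule.mem_span_singleton.1 hx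
    rw [LinearPMap.mkSpanSingleton'_apply]
    simp [hsmul, hv₀]
  obtain ⟨q, hpq, hqs, hq⟩ := zorn_le_nonempty₀ S hSc _ hp
  have htop : q.domain = ⊤ := by
    by_contra hne
    obtain ⟨r, hqr, hr⟩ := exists_lt_of_domain_ne_top hK hsmul hadd q hqs hne
    exact hqr.not_ge (hq hr hqr.le)
  have hmem : ∀ v, v ∈ q.domain := fun v => htop ▸ Submodule.mem_top
  refine ⟨q.toFun.comp (LinearMap.id.codRestrict q.domain hmem), ?_, fun v => hqs ⟨v, hmem v⟩⟩
  have h := hpq.2 (x := ⟨v₀, Submodule.mem_span_singleton_self v₀⟩) (y := ⟨v₀, hmem v₀⟩) rfl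
  rw [LinearPMap.mkSpanSingleton_apply] at h
  exact h.symm

end Ingleton

/-- The tensor product is an ultrametric normed `K`-space in which `1` has norm `1`. A contractive
functional equal to `1` there, composed with `r ↦ r ⊗ 1`, sends `1` to `1`. -/
theorem exists_contractive_of_isMinimal {R : Type u} [NormedRing R] [NormOneClass R]
    {α : Cardinal.{v}} (K : ValField α) (hu : K.IsUm) (hm : K.IsMinimal)
    [Nontrivial (UmBanachTensor R K)] :
    ∃ ψ : R →+ K, ψ ≠ 0 ∧ ∀ x, ‖ψ x‖ ≤ ‖x‖ := by
  let _ : Module K (UmBanachTensor R K) := Module.compHom _ (umRight R K)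
  obtain ⟨φ, h1, hφ⟩ := exists_contractive_functional (V := UmBanachTensor R K)
    (ValField.IsMinimal.isSphericallyComplete hu hm)
    (norm_scalar_mul (umRight R K) norm_umRight_le)
    (fun x y => by exact_mod_cast nnnorm_umBanachTensor_add_le x y) 1
    (norm_one_of_nontrivial (umRight R K) norm_umRight_le)
  refine ⟨φ.toAddMonoidHom.comp (umLeft R K).toAddMonoidHom, fun h => ?_,
    fun x => (hφ _).trans (norm_umLeft_le x)⟩
  have := DFunLike.congr_fun h 1
  simp [h1] at this

end

end BanachRing

open BanachRing
theorem mainTheorem1 {R : Type u} [NormedRing R] [NormOneClass R] [CompleteSpace R] (a : R)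
    (α : Cardinal.{v}) (hα : Cardinal.aleph0 ≤ α) :
    (IsCompact (umSpectrum α a) ∧ IsCompact (berSpectrum α a)) ∧
    (((umSpectrum α a).Nonempty ↔
        ∃ K : ValField α, K.IsUm ∧ K.IsMinimal ∧ Nontrivial (UmBanachTensor R K)) ∧
      ((umSpectrum α a).Nonempty ↔
        ∃ (L : ValField α) (ψ : R →+ L), L.IsUm ∧ ψ ≠ 0 ∧ ∀ x, ‖ψ x‖ ≤ ‖x‖)) ∧
    ((∃ (L : ValField α) (ψ : R →+ L), ψ ≠ 0 ∧ ∀ x, ‖ψ x‖ ≤ ‖x‖) →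
      (berSpectrum α a).Nonempty) := by
  have h12 : (umSpectrum α a).Nonempty →
      ∃ K : ValField α, K.IsUm ∧ K.IsMinimal ∧ Nontrivial (UmBanachTensor R K) := by
    rintro ⟨_, _, ⟨K, s, -, hK, -⟩, -⟩
    exact exists_minimal_subfield K
  have h23 : (∃ K : ValField α, K.IsUm ∧ K.IsMinimal ∧ Nontrivial (UmBanachTensor R K)) →
      ∃ (L : ValField α) (ψ : R →+ L), L.IsUm ∧ ψ ≠ 0 ∧ ∀ x, ‖ψ x‖ ≤ ‖x‖ := by
    rintro ⟨K, hu, hm, hK⟩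
    obtain ⟨ψ, h0, hψ⟩ := exists_contractive_of_isMinimal (R := R) K hu hm
    exact ⟨K, ψ, hu, h0, hψ⟩
  have h31 : (∃ (L : ValField α) (ψ : R →+ L), L.IsUm ∧ ψ ≠ 0 ∧ ∀ x, ‖ψ x‖ ≤ ‖x‖) →
      (umSpectrum α a).Nonempty := by
    rintro ⟨L, ψ, hL, h0, hψ⟩
    have : IsUltrametricDist L := hL
    obtain ⟨N, hN⟩ := exists_isSpectral_max a ψ h0 hψ
    rw [umSpectrum_eq_range α hα a]
    exact ⟨_, ⟨N, hN⟩, rfl⟩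
  refine ⟨⟨?_, ?_⟩, ⟨⟨h12, fun h => h31 (h23 h)⟩, ⟨fun h => h23 (h12 h), h31⟩⟩, fun _ => ?_⟩
  · rw [umSpectrum_eq_range α hα a]
    exact isCompact_range_toAffineLine _ a
  · rw [berSpectrum_eq_range α hα a]
    exact isCompact_range_toAffineLine _ a
  · obtain ⟨N, hN⟩ := exists_isSpectral_add a
    rw [berSpectrum_eq_range α hα a]
    exact ⟨_, ⟨N, hN⟩, rfl⟩
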